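/- Let $\mathbb H_1=\{(a,b,c)\in\mathbb R^3\}$ be the Heisenberg group with law $(a,b,c)(a',b',c')=(a+a',b+b',c+c'+ab')$, let $\Gamma$ be its subgroup of elements with integer coordinates, and let $M=\Gamma\backslash\mathbb H_1$, with the measure that is $da\,db\,dc$ on the fundamental domain $[0,1)^3$. The left-invariant vector fields $A=\partial_a$ and $B=\partial_b+a\partial_c$ descend to vector fields $A_M,B_M$ on $M$; the sub-Laplacian of $M$ is $\mathcal L_M=-(A_M^2+B_M^2)$. For $\lambda\in\mathbb Z$ put $$L^2_\lambda(M)=\{f\in L^2(M): f(\Gamma(a,b,c))=f(\Gamma(a,b,0))\,e^{2\pi i\lambda c}\}.$$ For $\omega=(\omega_1,\omega_2)\in\mathbb Z^2$ let $\chi_\omega(\Gamma(a,b,c))=e^{2\pi i(\omega_1a+\omega_2b)}$. For $\ell\in\mathbb N_0$ and $\lambda\in\mathbb Z\setminus\{0\}$ let $h_{\ell,\lambda}(u)=(2\pi|\lambda|)^{1/4}h_\ell(\sqrt{2\pi|\lambda|}\,u)$, where $h_\ell(u)=(\sqrt\pi\,2^\ell\,\ell!)^{-1/2}H_\ell(u)e^{-u^2/2}$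 and $H_\ell(u)=(-1)^\ell e^{u^2}\frac{d^\ell}{du^\ell}e^{-u^2}$. For $\lambda\in\mathbb Z\setminus\{0\}$, $q\in\mathbb Z/\lambda\mathbb Z$ and $\ell\in\mathbb N_0$ let $$h_{\lambda,q,\ell}(\Gamma(a,b,c))=\frac{\sqrt{|\lambda|}}{\lambda}\sum_{k\in\mathbb Z}e^{-2\pi iqk/\lambda}\,e^{2\pi i(\lambda c+kb)}\,h_{\ell,\lambda}\Big(\frac k\lambda+a\Big).$$ This is the Berezin–Weil–Zak transform $\mathrm{BWZ}_{\lambda,q}h_{\ell,\lambda}$; it is well defined on $M$ and depends only on the class of $q$ modulo $\lambda$. **Theorem.** The series above converge absolutely. The functions $\chi_\omega$ $(\omega\in\mathbb Z^2)$ and $h_{\lambda,q,\ell}$ $(\lambda\in\mathbb Z\setminus\{0\},\ q\in\mathbb Z/\lambda\mathbb Z,\ \ell\in\mathbb N_0)$ are smooth on $M$, satisfy $\|\chi_\omega\|_{L^2(M)}=1$ and $\|h_{\lambda,q,\ell}\|_{L^2(M)}=1$, and are eigenfunctions of $\mathcal L_M$: $$\mathcal L_M\chi_\omega=(2\pi)^2|\omega|^2\chi_\omega,\qquad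 \mathcal L_Mh_{\lambda,q,\ell}=2\pi|\lambda|(2\ell+1)\,h_{\lambda,q,\ell}.$$ Moreover $L^2(M)=\bigoplus^\perp_{\lambda\in\mathbb Z}L^2_\lambda(M)$ (orthogonal Hilbert sum), and all these functions together form an orthonormal basis of $L^2(M)$. More precisely, $(\chi_\omega)_{\omega\in\mathbb Z^2}$ is an orthonormal basis of $L^2_0(M)$ and, for each $\lambda\in\mathbb Z\setminus\{0\}$, $(h_{\lambda,q,\ell})_{q\in\mathbb Z/\lambda\mathbb Z,\ \ell\in\mathbb N_0}$ is an orthonormal basis of $L^2_\lambda(M)$. -/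

import Mathlib

namespace HeisenbergNil

/-! ### The Heisenberg group and its standard nilmanifold -/

/-- The three-dimensional Heisenberg group, in the coordinates `(a, b, c)` of the upper triangular
unipotent real matrix with rows `(1, a, c)`, `(0, 1, b)`, `(0, 0, 1)`. -/
@[ext]
structure Heis where
  a : ℝ
  b : ℝ
  c : ℝ

namespace Heis

/-- The group law `(a,b,c)(a',b',c') = (a+a', b+b', c+c'+ab')`. -/
instance : Mul Heis := ⟨fun x y => ⟨x.a + y.a, x.b + y.b, x.c + y.c + x.a * y.b⟩⟩
instance : One Heis := ⟨⟨0, 0, 0⟩⟩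
instance : Inv Heis := ⟨fun x => ⟨-x.a, -x.b, -x.c + x.a * x.b⟩⟩

@[simp] lemma mul_a (x y : Heis) : (x * y).a = x.a + y.a := rfl
@[simp] lemma mul_b (x y : Heis) : (x * y).b = x.b + y.b := rfl
@[simp] lemma mul_c (x y : Heis) : (x * y).c = x.c + y.c + x.a * y.b := rfl
@[simp] lemma one_a : (1 : Heis).a = 0 := rfl
@[simp] lemma one_b : (1 : Heis).b = 0 := rfl
@[simp] lemma one_c : (1 : Heis).c = 0 := rfl
@[simp] lemma inv_a (x : Heis) : (x⁻¹).a = -x.a := rfl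
@[simp] lemma inv_b (x : Heis) : (x⁻¹).b = -x.b := rfl
@[simp] lemma inv_c (x : Heis) : (x⁻¹).c = -x.c + x.a * x.b := rfl

instance : Group Heis :=
  Group.ofLeftAxioms
    (fun x y z => by ext <;> simp <;> ring)
    (fun x => by ext <;> simp)
    (fun x => by ext <;> simp)

/-- The global coordinates identifying the group with `ℝ³`. -/
def coord : Heis ≃ ℝ × ℝ × ℝ where
  toFun x := (x.a, x.b, x.c)
  invFun p := ⟨p.1, p.2.1, p.2.2⟩
  left_inv _ := rfl
  right_inv _ := rfl

/-- The Borel structure of `ℝ³`. -/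
instance : MeasurableSpace Heis := MeasurableSpace.comap coord inferInstance

/-- The Haar measure `da db dc`. -/
noncomputable def haar : MeasureTheory.Measure Heis :=
  (MeasureTheory.volume : MeasureTheory.Measure (ℝ × ℝ × ℝ)).map coord.symm

end Heis

/-- The discrete subgroup of the elements with integer coordinates. -/
def Gam : Subgroup Heis where
  carrier := {x | ∃ m n p : ℤ, x = ⟨m, n, p⟩}
  one_mem' := ⟨0, 0, 0, by ext <;> simp⟩
  mul_mem' := by
    rintro _ _ ⟨m, n, p, rfl⟩ ⟨m', n', p', rfl⟩
    exact ⟨m + m', n + n', p + p' + m * n', by ext <;> simp⟩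
  inv_mem' := by
    rintro _ ⟨m, n, p, rfl⟩
    exact ⟨-m, -n, -p + m * n, by ext <;> simp⟩

/-- The Heisenberg nilmanifold `M = Γ \ H`: the set of the classes `Γ x`. Its σ-algebra is the
quotient one. -/
abbrev Nil : Type := Quotient (QuotientGroup.rightRel Gam)

/-- The canonical projection `x ↦ Γ x`. -/
def proj (x : Heis) : Nil := Quotient.mk (QuotientGroup.rightRel Gam) x

/-- The fundamental domain `[0,1)³`. -/
def fundDomain : Set Heis :=
  {x | x.a ∈ Set.Ico (0 : ℝ) 1 ∧ x.b ∈ Set.Ico (0 : ℝ) 1 ∧ x.c ∈ Set.Ico (0 : ℝ) 1}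

/-- The measure of `M` induced by the Haar measure `da db dc` of the group and the counting measure
of `Γ`: it is `da db dc` on the fundamental domain `[0,1)³`. -/
noncomputable def nilMeasure : MeasureTheory.Measure Nil :=
  (Heis.haar.restrict fundDomain).map proj

/-- The Hilbert space `L²(M)`. -/
noncomputable abbrev L2M : Type := MeasureTheory.Lp ℂ 2 nilMeasure

/-- Descent to `M` of a function on the group that is invariant under left multiplication
by `Γ`. -/
def descend (φ : Heis → ℂ)
    (hφ : ∀ (m n p : ℤ) (x : Heis), φ ((⟨m, n, p⟩ : Heis) * x) = φ x) : Nil → ℂ :=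
  Quotient.lift φ (by
    intro x y hxy
    obtain ⟨m, n, p, h⟩ := QuotientGroup.rightRel_apply.mp hxy
    have hy : y = (⟨m, n, p⟩ : Heis) * x := by rw [← h]; group
    rw [hy, hφ])

/-- Smooth functions on `M`. The projection of the group onto `M` is a local diffeomorphism, hence a
function on `M` is smooth exactly when its `Γ`-periodic lift to the group is a smooth function of
the coordinates `(a, b, c)`. -/
def IsSmooth (F : Nil → ℂ) : Prop :=
  ContDiff ℝ ((⊤ : ℕ∞) : WithTop ℕ∞) (fun p : ℝ × ℝ × ℝ => F (proj (Heis.coord.symm p)))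

/-! ### Left-invariant vector fields and the sub-Laplacian -/

/-- The right translation `Γ x ↦ Γ x g` of `M`. -/
def rightTranslate (p : Nil) (g : Heis) : Nil :=
  Quotient.map (fun x => x * g) (by
    intro x y hxy
    have h := QuotientGroup.rightRel_apply.mp hxy
    exact QuotientGroup.rightRel_apply.mpr (by simpa [mul_assoc] using h)) p

/-- The vector field of `M` that comes from the left-invariant vector field `A = ∂_a`:
`A_M F (Γ x) = d/dt F (Γ x exp(tA))` at `t = 0`, with `exp(tA) = (t, 0, 0)`. -/
noncomputable def fieldA (F : Nil → ℂ) (p : Nil) : ℂ :=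
  deriv (fun t : ℝ => F (rightTranslate p ⟨t, 0, 0⟩)) 0

/-- The vector field of `M` that comes from the left-invariant vector field `B = ∂_b + a ∂_c`:
`B_M F (Γ x) = d/dt F (Γ x exp(tB))` at `t = 0`, with `exp(tB) = (0, t, 0)`. -/
noncomputable def fieldB (F : Nil → ℂ) (p : Nil) : ℂ :=
  deriv (fun t : ℝ => F (rightTranslate p ⟨0, t, 0⟩)) 0

/-- The sub-Laplacian `L_M = -(A_M² + B_M²)`, acting on (smooth) functions on `M`. -/
noncomputable def subLaplacian (F : Nil → ℂ) (p : Nil) : ℂ :=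
  -(fieldA (fieldA F) p + fieldB (fieldB F) p)

/-! ### The subspaces of the Fourier decomposition in the central variable -/

/-- The subspace `L²_λ(M)` of the `f ∈ L²(M)` with `f(Γ(a,b,c)) = f(Γ(a,b,0)) e^{2πiλc}`. As `f` is
a class of functions modulo null sets, the identity is asked of one of its representatives. -/
noncomputable def L2sub (lam : ℤ) : Submodule ℂ L2M where
  carrier := {f | ∃ F : Nil → ℂ, f =ᵐ[nilMeasure] F ∧ ∀ a b c : ℝ,
    F (proj ⟨a, b, c⟩) = F (proj ⟨a, b, 0⟩) * Complex.exp (2 * Real.pi * Complex.I * lam * c)}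
  zero_mem' := ⟨0, MeasureTheory.Lp.coeFn_zero _ _ _, by simp⟩
  add_mem' := by
    rintro f g ⟨F, hF, hF'⟩ ⟨G, hG, hG'⟩
    refine ⟨F + G, (MeasureTheory.Lp.coeFn_add f g).trans (hF.add hG), fun a b c => ?_⟩
    simp only [Pi.add_apply]
    rw [hF', hG', add_mul]
  smul_mem' := by
    rintro z f ⟨F, hF, hF'⟩
    refine ⟨z • F, (MeasureTheory.Lp.coeFn_smul z f).trans (hF.const_smul z), fun a b c => ?_⟩
    simp only [Pi.smul_apply, smul_eq_mul]
    rw [hF', ← mul_assoc]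

/-! ### The characters -/

/-- The function `χ_ω(Γ(a,b,c)) = exp(2πi (ω₁ a + ω₂ b))`. -/
noncomputable def chi (ω : ℤ × ℤ) : Nil → ℂ :=
  descend (fun x => Complex.exp (2 * Real.pi * Complex.I * (ω.1 * x.a + ω.2 * x.b))) (by
    intro m n p x
    refine Complex.exp_eq_exp_iff_exists_int.mpr ⟨ω.1 * m + ω.2 * n, ?_⟩
    simp only [Heis.mul_a, Heis.mul_b]
    push_cast
    ring)

/-! ### Hermite functions -/

/-- The Hermite polynomial `H_ℓ(u) = (-1)^ℓ e^{u²} (d/du)^ℓ e^{-u²}`. -/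
noncomputable def hermiteH (l : ℕ) (u : ℝ) : ℝ :=
  (-1) ^ l * Real.exp (u ^ 2) * iteratedDeriv l (fun v : ℝ => Real.exp (-v ^ 2)) u

/-- The Hermite function `h_ℓ(u) = (√π 2^ℓ ℓ!)^{-1/2} H_ℓ(u) e^{-u²/2}`. -/
noncomputable def hermiteFun (l : ℕ) (u : ℝ) : ℝ :=
  (√Real.pi * 2 ^ l * (l.factorial : ℝ)) ^ (-(1 / 2) : ℝ) * hermiteH l u * Real.exp (-u ^ 2 / 2)

/-- The rescaled Hermite function `h_{ℓ,λ}(u) = (2π|λ|)^{1/4} h_ℓ(√(2π|λ|) u)`. -/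
noncomputable def hermiteScaled (l : ℕ) (lam : ℝ) (u : ℝ) : ℝ :=
  (2 * Real.pi * |lam|) ^ (1 / 4 : ℝ) * hermiteFun l (√(2 * Real.pi * |lam|) * u)

/-! ### The Berezin-Weil-Zak transform -/

/-- The `k`-th term `e^{-2πi q k/λ} e^{2πi(λc + kb)} h(k/λ + a)` of the series that defines the
Berezin-Weil-Zak transform of `h` at `Γ(a,b,c)`. -/
noncomputable def bwzTerm (lam q : ℤ) (h : ℝ → ℂ) (x : Heis) (k : ℤ) : ℂ :=
  Complex.exp (-(2 * Real.pi * Complex.I * q * (k / lam))) *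
    Complex.exp (2 * Real.pi * Complex.I * (lam * x.c + k * x.b)) *
    h ((k : ℝ) / (lam : ℝ) + x.a)

lemma bwzTerm_mul {lam : ℤ} (hlam : lam ≠ 0) (q : ℤ) (h : ℝ → ℂ) (m n p : ℤ) (x : Heis) (k : ℤ) :
    bwzTerm lam q h ((⟨m, n, p⟩ : Heis) * x) k = bwzTerm lam q h x (k + lam * m) := by
  have hl : (lam : ℂ) ≠ 0 := by exact_mod_cast hlam
  have hl' : (lam : ℝ) ≠ 0 := by exact_mod_cast hlam
  simp only [bwzTerm, Heis.mul_a, Heis.mul_b, Heis.mul_c]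
  have harg : (k : ℝ) / (lam : ℝ) + ((m : ℝ) + x.a)
      = ((k + lam * m : ℤ) : ℝ) / (lam : ℝ) + x.a := by
    push_cast; field_simp; ring
  rw [harg]
  congr 1
  rw [← Complex.exp_add, ← Complex.exp_add]
  refine Complex.exp_eq_exp_iff_exists_int.mpr ⟨lam * p + k * n + q * m, ?_⟩
  push_cast
  field_simp
  ring

lemma bwzTerm_add {lam : ℤ} (hlam : lam ≠ 0) (q j : ℤ) (h : ℝ → ℂ) (x : Heis) (k : ℤ) :
    bwzTerm lam (q + lam * j) h x k = bwzTerm lam q h x k := by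
  have hl : (lam : ℂ) ≠ 0 := by exact_mod_cast hlam
  simp only [bwzTerm]
  congr 2
  refine Complex.exp_eq_exp_iff_exists_int.mpr ⟨-(j * k), ?_⟩
  push_cast
  field_simp
  ring

/-- The Berezin-Weil-Zak transform of a (rapidly decaying) function `h` on the real line,
`BWZ_{λ,q}(h)(Γ(a,b,c)) = (√|λ| / λ) ∑_{k ∈ ℤ} e^{-2πi q k/λ} e^{2πi(λc + kb)} h(k/λ + a)`,
for `q ∈ ℤ` and `λ ∈ ℤ \ {0}`. -/
noncomputable def bwz (lam q : ℤ) (h : ℝ → ℂ) : Nil → ℂ :=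
  descend (fun x => ((√|(lam : ℝ)| / (lam : ℝ) : ℝ) : ℂ) * ∑' k : ℤ, bwzTerm lam q h x k) (by
    intro m n p x
    rcases eq_or_ne lam 0 with rfl | hlam
    · simp
    · simp_rw [bwzTerm_mul hlam q h m n p x]
      congr 1
      exact (Equiv.addRight (lam * m)).tsum_eq (bwzTerm lam q h x))

lemma bwz_add (lam q j : ℤ) (h : ℝ → ℂ) : bwz lam (q + lam * j) h = bwz lam q h := by
  rcases eq_or_ne lam 0 with rfl | hlam
  · simp
  · funext p
    induction p using Quotient.inductionOn with
    | h x => simp only [bwz, descend, Quotient.lift_mk, bwzTerm_add hlam q j h x]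

/-- The group `ℤ/λℤ`. -/
abbrev ZModInt (lam : ℤ) : Type := ℤ ⧸ AddSubgroup.zmultiples lam

/-- The function `h_{λ,q,ℓ} = BWZ_{λ,q} h_{ℓ,λ}` on `M`, with `q ∈ ℤ/λℤ`. -/
noncomputable def hFun (lam : ℤ) (q : ZModInt lam) (l : ℕ) : Nil → ℂ :=
  Quotient.liftOn' q (fun q₀ : ℤ => bwz lam q₀ (fun u => (hermiteScaled l lam u : ℂ))) (by
    intro q₁ q₂ hq
    obtain ⟨j, hj⟩ := AddSubgroup.mem_zmultiples_iff.mp (QuotientAddGroup.leftRel_apply.mp hq)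
    have h2 : q₂ = q₁ + lam * j := by
      rw [smul_eq_mul] at hj
      linarith
    simp only [h2, bwz_add])

/-- The index set of the functions `h_{λ,q,ℓ}`: `λ ∈ ℤ \ {0}`, `q ∈ ℤ/λℤ`, `ℓ ∈ ℕ`. -/
abbrev HIndex : Type := Σ lam : {lam : ℤ // lam ≠ 0}, ZModInt lam.1 × ℕ

end HeisenbergNil

open HeisenbergNil

/-!
Plancherel for the Fourier series in `b` turns `BWZ_{λ,q}` into an isometry `L²(ℝ) → L²_λ(M)`, and
the characters of `ℤ/λℤ` make the ranges for different `q` orthogonal. It intertwines `A_M` with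
`d/du` and `B_M` with multiplication by `2πiλu`, so that it carries the harmonic oscillator
`-d²/du² + (2πλu)²`, which the functions `h_{ℓ,λ}` diagonalise, to the sub-Laplacian.

The completeness of the Hermite functions is that of the ladder of the oscillator: a function
orthogonal to all `uˡ e^{-πλu²}` has vanishing Fourier transform. For the completeness on `M`, sums
over `q` and `f` supported in an interval of length `1` reduce the series `BWZ_{λ,q} f` to a single
term, and these terms approximate the characters of the torus `(ℝ/ℤ)³`.
-/

namespace HeisenbergNil

open Filter MeasureTheory Polynomial SchwartzMap
open scoped ComplexConjugate InnerProductSpace FourierTransform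

/-! ### Ladder operators on Schwartz functions -/

section Ladder

/-- The position operator `f ↦ (u ↦ u f(u))` on Schwartz functions. -/
noncomputable def position : 𝓢(ℝ, ℂ) →L[ℂ] 𝓢(ℝ, ℂ) :=
  smulLeftCLM ℂ (fun u : ℝ => (u : ℂ))

/-- The raising operator `f ↦ α u f - f'`. -/
noncomputable def raising (α : ℝ) : 𝓢(ℝ, ℂ) →L[ℂ] 𝓢(ℝ, ℂ) :=
  (α : ℂ) • position - derivCLM ℂ ℂ

/-- The lowering operator `f ↦ α u f + f'`, the formal adjoint of the raising operator. -/
noncomputable def lowering (α : ℝ) : 𝓢(ℝ, ℂ) →L[ℂ] 𝓢(ℝ, ℂ) :=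
  (α : ℂ) • position + derivCLM ℂ ℂ

/-- The harmonic oscillator `f ↦ α² u² f - f''`. -/
noncomputable def oscillator (α : ℝ) : 𝓢(ℝ, ℂ) →L[ℂ] 𝓢(ℝ, ℂ) :=
  (α : ℂ) ^ 2 • position ∘L position - derivCLM ℂ ℂ ∘L derivCLM ℂ ℂ

variable (α : ℝ) (f g : 𝓢(ℝ, ℂ))

lemma position_apply (u : ℝ) : position f u = u * f u := by
  rw [position, smulLeftCLM_apply_apply (by fun_prop), smul_eq_mul]

lemma raising_apply (u : ℝ) : raising α f u = α * (u * f u) - deriv f u := by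
  simp [raising, position_apply]

lemma derivCLM_position : derivCLM ℂ ℂ (position f) = f + position (derivCLM ℂ ℂ f) := by
  ext u
  have h : HasDerivAt (fun v : ℝ => (v : ℂ) * f v) (1 * f u + u * deriv f u) u :=
    Complex.ofRealCLM.hasDerivAt.mul (f.hasDerivAt u)
  rw [derivCLM_apply, funext (position_apply f), h.deriv]
  simp [position_apply]

lemma lowering_raising : lowering α (raising α f) = raising α (lowering α f) + (2 * α : ℂ) • f := by
  simp only [lowering, raising, sub_apply, add_apply, smul_apply, map_add, map_sub,
    map_smul, derivCLM_position]
  module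

lemma oscillator_eq : oscillator α f = raising α (lowering α f) + (α : ℂ) • f := by
  simp only [oscillator, lowering, raising, sub_apply, add_apply, smul_apply,
    ContinuousLinearMap.comp_apply, map_add, map_smul, derivCLM_position]
  module

lemma position_eq {α : ℝ} (hα : α ≠ 0) :
    position f = (2 * α : ℂ)⁻¹ • (raising α f + lowering α f) := by
  have h : raising α f + lowering α f = (2 * α : ℂ) • position f := by
    simp only [lowering, raising, sub_apply, add_apply, smul_apply]
    module
  rw [h, inv_smul_smul₀ (by simpa using hα)]

/-- The inclusion of the Schwartz functions in `L²(ℝ)`. -/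
noncomputable def schwartzL2 : 𝓢(ℝ, ℂ) →L[ℂ] Lp ℂ 2 (volume : Measure ℝ) :=
  toLpCLM ℂ ℂ 2 volume

lemma inner_schwartzL2 : ⟪schwartzL2 f, schwartzL2 g⟫_ℂ = ∫ u, conj (f u) * g u := by
  simp only [schwartzL2, toLpCLM_apply, inner_toL2_toL2_eq, RCLike.inner_apply']

lemma inner_schwartzL2_position :
    ⟪schwartzL2 (position f), schwartzL2 g⟫_ℂ = ⟪schwartzL2 f, schwartzL2 (position g)⟫_ℂ := by
  simp only [inner_schwartzL2, position_apply, map_mul, Complex.conj_ofReal]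
  exact integral_congr_ae (ae_of_all _ fun u => by ring)

lemma inner_schwartzL2_derivCLM :
    ⟪schwartzL2 (derivCLM ℂ ℂ f), schwartzL2 g⟫_ℂ =
      -⟪schwartzL2 f, schwartzL2 (derivCLM ℂ ℂ g)⟫_ℂ := by
  simp only [inner_schwartzL2, derivCLM_apply]
  exact neg_eq_iff_eq_neg.mp <| Eq.symm (integral_bilinear_deriv_right_eq_neg_left f g
    ((ContinuousLinearMap.mul ℝ ℂ).comp (Complex.conjCLE : ℂ →L[ℝ] ℂ)))

lemma inner_schwartzL2_raising :
    ⟪schwartzL2 (raising α f), schwartzL2 g⟫_ℂ = ⟪schwartzL2 f, schwartzL2 (lowering α g)⟫_ℂ := by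
  simp only [raising, lowering, sub_apply, add_apply, smul_apply, map_sub, map_add, map_smul,
    inner_sub_left, inner_add_right, inner_smul_left, inner_smul_right, Complex.conj_ofReal,
    inner_schwartzL2_position, inner_schwartzL2_derivCLM, sub_neg_eq_add]

end Ladder

/-! ### The eigenfunctions of the harmonic oscillator -/

section Gaussian

lemma hasDerivAt_exp_neg_mul_sq_div_two (α u : ℝ) :
    HasDerivAt (fun v : ℝ => Real.exp (-α * v ^ 2 / 2))
      (-(α * u) * Real.exp (-α * u ^ 2 / 2)) u := by
  refine (((hasDerivAt_pow 2 u).const_mul (-α)).div_const 2).exp.congr_deriv ?_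
  push_cast
  ring

lemma exists_iteratedDeriv_exp_neg_mul_sq_div_two (α : ℝ) (n : ℕ) :
    ∃ P : ℝ[X], iteratedDeriv n (fun v : ℝ => Real.exp (-α * v ^ 2 / 2)) =
      fun u => P.eval u * Real.exp (-α * u ^ 2 / 2) := by
  induction n with
  | zero => exact ⟨1, by simp⟩
  | succ n ih =>
    obtain ⟨P, hP⟩ := ih
    refine ⟨derivative P - C α * X * P, funext fun u => ?_⟩
    have h := (P.hasDerivAt u).mul (hasDerivAt_exp_neg_mul_sq_div_two α u)
    rw [iteratedDeriv_succ, hP]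
    refine h.deriv.trans ?_
    simp only [eval_sub, eval_mul, eval_C, eval_X]
    ring

lemma tendsto_eval_mul_exp_neg_mul_sq_div_two {α : ℝ} (hα : 0 < α) (P : ℝ[X]) :
    Tendsto (fun u => P.eval u * Real.exp (-α * u ^ 2 / 2)) (cocompact ℝ)
      (nhds 0) := by
  induction P using Polynomial.induction_on' with
  | add P Q hP hQ => simpa only [eval_add, add_mul, add_zero] using hP.add hQ
  | monomial n c =>
    have h := tendsto_rpow_abs_mul_exp_neg_mul_sq_cocompact (half_pos hα) n
    have h' := h.const_mul |c|
    rw [mul_zero] at h'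
    refine squeeze_zero_norm (fun u => le_of_eq ?_) h'
    rw [eval_monomial, norm_mul, norm_mul, norm_pow, Real.norm_eq_abs, Real.norm_eq_abs,
      Real.norm_eq_abs, Real.abs_exp, Real.rpow_natCast, mul_assoc]
    ring_nf

lemma exists_norm_eval_mul_exp_le {α : ℝ} (hα : 0 < α) (P : ℝ[X]) :
    ∃ K, ∀ u, ‖P.eval u * Real.exp (-α * u ^ 2 / 2)‖ ≤ K := by
  let φ : ZeroAtInftyContinuousMap ℝ ℝ :=
    ⟨⟨fun u => P.eval u * Real.exp (-α * u ^ 2 / 2), by fun_prop⟩,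
      tendsto_eval_mul_exp_neg_mul_sq_div_two hα P⟩
  obtain ⟨K, hK⟩ := φ.isBounded_range.exists_norm_le
  exact ⟨K, fun u => hK _ ⟨u, rfl⟩⟩

/-- The Gaussian `u ↦ e^{-α u² / 2}` as a Schwartz function. -/
noncomputable def gaussian {α : ℝ} (hα : 0 < α) : 𝓢(ℝ, ℂ) :=
  postcompCLM (𝕜 := ℝ) Complex.ofRealCLM
    { toFun u := Real.exp (-α * u ^ 2 / 2)
      smooth' := by fun_prop
      decay' k n := by
        obtain ⟨P, hP⟩ := exists_iteratedDeriv_exp_neg_mul_sq_div_two α n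
        obtain ⟨K, hK⟩ := exists_norm_eval_mul_exp_le hα (X ^ k * P)
        refine ⟨K, fun u => le_trans (le_of_eq ?_) (hK u)⟩
        rw [norm_iteratedFDeriv_eq_norm_iteratedDeriv, hP, ← norm_pow, ← norm_mul, eval_mul,
          eval_pow, eval_X, mul_assoc] }

lemma gaussian_apply {α : ℝ} (hα : 0 < α) (u : ℝ) :
    gaussian hα u = (Real.exp (-α * u ^ 2 / 2) : ℂ) :=
  rfl

lemma lowering_gaussian {α : ℝ} (hα : 0 < α) : lowering α (gaussian hα) = 0 := by
  ext u
  have h : deriv (gaussian hα) u = ((-(α * u) * Real.exp (-α * u ^ 2 / 2) : ℝ) : ℂ) :=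
    (hasDerivAt_exp_neg_mul_sq_div_two α u).ofReal_comp.deriv
  simp only [lowering, add_apply, smul_apply, derivCLM_apply, position_apply, h, gaussian_apply,
    zero_apply, smul_eq_mul]
  push_cast
  ring

lemma inner_gaussian {α : ℝ} (hα : 0 < α) :
    ⟪schwartzL2 (gaussian hα), schwartzL2 (gaussian hα)⟫_ℂ = (√(Real.pi / α) : ℂ) := by
  rw [← integral_gaussian, inner_schwartzL2, ← integral_complex_ofReal]
  congr 1 with u
  rw [gaussian_apply, Complex.conj_ofReal, ← Complex.ofReal_mul, ← Real.exp_add]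
  congr 2
  ring

end Gaussian

section HermiteSchwartz

/-- The unnormalized eigenfunctions of the harmonic oscillator: the raising operator applied `l`
times to the Gaussian. -/
noncomputable def ladder {α : ℝ} (hα : 0 < α) (l : ℕ) : 𝓢(ℝ, ℂ) :=
  (raising α)^[l] (gaussian hα)

variable {α : ℝ} (hα : 0 < α)

lemma ladder_succ (l : ℕ) : ladder hα (l + 1) = raising α (ladder hα l) :=
  Function.iterate_succ_apply' _ _ _

lemma lowering_ladder (l : ℕ) :
    lowering α (ladder hα l) = (2 * α * l : ℂ) • ladder hα (l - 1) := by
  induction l with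
  | zero => simp [ladder, lowering_gaussian]
  | succ l ih =>
    have h : (l : ℂ) • raising α (ladder hα (l - 1)) = (l : ℂ) • ladder hα l := by
      cases l with
      | zero => simp
      | succ l => rw [Nat.add_sub_cancel, ladder_succ]
    rw [Nat.add_sub_cancel, ladder_succ, lowering_raising, ih, map_smul, mul_smul, h]
    push_cast
    module

lemma oscillator_ladder (l : ℕ) :
    oscillator α (ladder hα l) = (α * (2 * l + 1) : ℂ) • ladder hα l := by
  rw [oscillator_eq, lowering_ladder, map_smul]
  cases l with
  | zero => simp
  | succ l =>
    rw [Nat.add_sub_cancel, ← ladder_succ]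
    module

lemma inner_ladder_succ_left (m n : ℕ) :
    ⟪schwartzL2 (ladder hα (m + 1)), schwartzL2 (ladder hα n)⟫_ℂ =
      2 * α * n * ⟪schwartzL2 (ladder hα m), schwartzL2 (ladder hα (n - 1))⟫_ℂ := by
  rw [ladder_succ, inner_schwartzL2_raising, lowering_ladder, map_smul, inner_smul_right]

lemma inner_ladder (m n : ℕ) :
    ⟪schwartzL2 (ladder hα m), schwartzL2 (ladder hα n)⟫_ℂ =
      if m = n then ((2 * α) ^ n * n.factorial * √(Real.pi / α) : ℂ) else 0 := by
  induction m generalizing n with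
  | zero =>
    cases n with
    | zero => simpa [ladder] using inner_gaussian hα
    | succ n => rw [← inner_conj_symm, inner_ladder_succ_left]; simp
  | succ m ih =>
    rw [inner_ladder_succ_left, ih]
    cases n with
    | zero => simp
    | succ n =>
      simp only [Nat.add_sub_cancel, Nat.add_right_cancel_iff, Nat.factorial_succ]
      split_ifs
      · push_cast
        ring
      · rw [mul_zero]

lemma ladder_apply (l : ℕ) (u : ℝ) :
    ladder hα l u = (((-1) ^ l * Real.exp (α * u ^ 2 / 2) *
      iteratedDeriv l (fun v : ℝ => Real.exp (-α * v ^ 2)) u : ℝ) : ℂ) := by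
  induction l generalizing u with
  | zero =>
    rw [ladder, Function.iterate_zero_apply, gaussian_apply, pow_zero, one_mul, iteratedDeriv_zero,
      ← Real.exp_add]
    congr 2
    ring
  | succ l ih =>
    have hexp : HasDerivAt (fun v : ℝ => Real.exp (α * v ^ 2 / 2))
        (α * u * Real.exp (α * u ^ 2 / 2)) u := by
      simpa using hasDerivAt_exp_neg_mul_sq_div_two (-α) u
    have hiter : HasDerivAt (iteratedDeriv l fun v : ℝ => Real.exp (-α * v ^ 2))
        (iteratedDeriv (l + 1) (fun v : ℝ => Real.exp (-α * v ^ 2)) u) u := by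
      rw [iteratedDeriv_succ, hasDerivAt_deriv_iff]
      have hsmooth : ContDiff ℝ (l + 1 : ℕ) fun v : ℝ => Real.exp (-α * v ^ 2) := by fun_prop
      exact (hsmooth.differentiable_iteratedDeriv l (by exact_mod_cast l.lt_succ_self)) u
    have hderiv : deriv (ladder hα l) u = _ :=
      (congrArg (deriv · u) (funext ih)).trans
        ((hexp.const_mul ((-1) ^ l)).mul hiter).ofReal_comp.deriv
    rw [ladder_succ, raising_apply, hderiv, ih]
    push_cast
    ring

end HermiteSchwartz

/-! ### Hermite functions -/

section Hermite

/-- The constant `α^{1/4} (√π 2^l l!)^{-1/2} α^{-l/2}` that normalizes `ladder` in `L²(ℝ)`. -/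
noncomputable def ladderNormalization (α : ℝ) (l : ℕ) : ℝ :=
  α ^ (1 / 4 : ℝ) * (√Real.pi * 2 ^ l * l.factorial) ^ (-(1 / 2) : ℝ) * (√α ^ l)⁻¹

lemma ladderNormalization_sq {α : ℝ} (hα : 0 < α) (l : ℕ) :
    ladderNormalization α l * ladderNormalization α l *
      ((2 * α) ^ l * l.factorial * √(Real.pi / α)) = 1 := by
  have hquarter : α ^ (1 / 4 : ℝ) * α ^ (1 / 4 : ℝ) = √α := by
    rw [← Real.rpow_add hα, Real.sqrt_eq_rpow]
    norm_num
  have hhalf : ∀ x : ℝ, 0 < x → x ^ (-(1 / 2) : ℝ) * x ^ (-(1 / 2) : ℝ) = x⁻¹ := fun x hx => by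
    rw [← Real.rpow_add hx, ← Real.rpow_neg_one]
    norm_num
  have hpow : √α ^ l * √α ^ l = α ^ l := by rw [← mul_pow, Real.mul_self_sqrt hα.le]
  calc _ = α ^ (1 / 4 : ℝ) * α ^ (1 / 4 : ℝ) *
          ((√Real.pi * 2 ^ l * l.factorial) ^ (-(1 / 2) : ℝ) *
            (√Real.pi * 2 ^ l * l.factorial) ^ (-(1 / 2) : ℝ)) *
          (√α ^ l * √α ^ l)⁻¹ * ((2 * α) ^ l * l.factorial * √(Real.pi / α)) := by
        rw [ladderNormalization, mul_inv]
        ring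
    _ = 1 := by
        rw [hquarter, hhalf _ (by positivity), hpow, Real.sqrt_div Real.pi_pos.le]
        field_simp
        rw [mul_pow]

lemma hermiteScaled_eq_ladder (l : ℕ) {lam : ℝ} (hlam : 0 < 2 * Real.pi * |lam|) (u : ℝ) :
    (hermiteScaled l lam u : ℂ) =
      ladderNormalization (2 * Real.pi * |lam|) l * ladder hlam l u := by
  rw [hermiteScaled, hermiteFun, hermiteH, ladder_apply, ladderNormalization, ← Complex.ofReal_mul]
  generalize 2 * Real.pi * |lam| = α at *
  have hsqrt : √α ^ 2 = α := Real.sq_sqrt hlam.le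
  have hiter : iteratedDeriv l (fun v : ℝ => Real.exp (-α * v ^ 2)) u =
      √α ^ l * iteratedDeriv l (fun v : ℝ => Real.exp (-v ^ 2)) (√α * u) := by
    have h := congrFun (iteratedDeriv_comp_const_mul (n := l)
      (show ContDiff ℝ l fun v : ℝ => Real.exp (-v ^ 2) by fun_prop) (√α)) u
    simpa only [mul_pow, hsqrt, neg_mul, smul_eq_mul] using h
  have hexp : Real.exp ((√α * u) ^ 2) * Real.exp (-(√α * u) ^ 2 / 2) =
      Real.exp (α * u ^ 2 / 2) := by
    rw [← Real.exp_add, mul_pow, hsqrt]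
    congr 1
    ring
  have hpos : √α ^ l ≠ 0 := (pow_pos (Real.sqrt_pos.mpr hlam) l).ne'
  rw [hiter, ← hexp]
  field_simp

/-- The rescaled Hermite function `h_{l,λ}` as a Schwartz function. -/
noncomputable def hermiteSchwartz {lam : ℝ} (hlam : lam ≠ 0) (l : ℕ) : 𝓢(ℝ, ℂ) :=
  (ladderNormalization (2 * Real.pi * |lam|) l : ℂ) • ladder (α := 2 * Real.pi * |lam|)
    (by positivity) l

variable {lam : ℝ} (hlam : lam ≠ 0)

lemma hermiteSchwartz_apply (l : ℕ) (u : ℝ) :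
    hermiteSchwartz hlam l u = (hermiteScaled l lam u : ℂ) := by
  rw [hermiteScaled_eq_ladder l (by positivity)]
  rfl

lemma oscillator_hermiteSchwartz (l : ℕ) :
    oscillator (2 * Real.pi * |lam|) (hermiteSchwartz hlam l) =
      (2 * Real.pi * |lam| * (2 * l + 1) : ℂ) • hermiteSchwartz hlam l := by
  rw [hermiteSchwartz, map_smul, oscillator_ladder, smul_comm]
  push_cast
  rfl

lemma orthonormal_hermiteSchwartz :
    Orthonormal ℂ fun l => schwartzL2 (hermiteSchwartz hlam l) := by
  rw [orthonormal_iff_ite]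
  intro m n
  simp only [hermiteSchwartz, map_smul, inner_smul_left, inner_smul_right, inner_ladder,
    Complex.conj_ofReal]
  split_ifs with h
  · subst h
    rw [← mul_assoc]
    exact_mod_cast ladderNormalization_sq (by positivity) m
  · simp

end Hermite

/-! ### Completeness of the Hermite functions -/

section Moments

lemma ae_eq_zero_of_fourier_eq_zero {V : Type*} [NormedAddCommGroup V] [InnerProductSpace ℝ V]
    [FiniteDimensional ℝ V] [MeasurableSpace V] [BorelSpace V] {F : V → ℂ} (hF : Integrable F)
    (h : 𝓕 F = 0) : F =ᵐ[volume] 0 := by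
  refine ae_eq_zero_of_integral_contDiff_smul_eq_zero hF.locallyIntegrable fun φ hφ hφc => ?_
  let ψ : 𝓢(V, ℂ) := HasCompactSupport.toSchwartzMap (f := Complex.ofRealCLM ∘ φ)
    (hφc.comp_left rfl) (Complex.ofRealCLM.contDiff.comp hφ)
  have hflip := VectorFourier.integral_fourierIntegral_smul_eq_flip (L := innerₗ V)
    (μ := volume) (ν := volume) Real.continuous_fourierChar continuous_inner
    (𝓕⁻ ψ).integrable hF
  rw [flip_innerₗ] at hflip
  calc ∫ x, φ x • F x = ∫ x, (𝓕 (𝓕⁻ ψ)) x • F x := by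
        rw [FourierTransform.fourier_fourierInv_eq]
        rfl
    _ = ∫ x, (𝓕⁻ ψ) x • (𝓕 F) x := hflip
    _ = 0 := by simp [h]

variable {F : ℝ → ℂ}

lemma integrable_of_integrable_exp_mul
    (hF : ∀ t : ℝ, Integrable fun u => (Real.exp (t * |u|) : ℂ) * F u) : Integrable F := by
  simpa using hF 0

lemma hasSum_integral_pow_mul
    (hF : ∀ t : ℝ, Integrable fun u => (Real.exp (t * |u|) : ℂ) * F u) (z : ℂ) :
    HasSum (fun n : ℕ => z ^ n / n.factorial * ∫ u : ℝ, (u : ℂ) ^ n * F u)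
      (∫ u : ℝ, Complex.exp (z * u) * F u) := by
  have hsummable (u : ℝ) : HasSum (fun n : ℕ => (‖z‖ * |u|) ^ n / n.factorial * ‖F u‖)
      (Real.exp (‖z‖ * |u|) * ‖F u‖) := by
    rw [Real.exp_eq_exp_ℝ]
    exact (NormedSpace.expSeries_div_hasSum_exp (‖z‖ * |u|)).mul_right ‖F u‖
  have hmeas : AEStronglyMeasurable F := (integrable_of_integrable_exp_mul hF).1
  have h := hasSum_integral_of_dominated_convergence (μ := volume)
    (F := fun (n : ℕ) (u : ℝ) => z ^ n / n.factorial * ((u : ℂ) ^ n * F u))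
    (f := fun u => Complex.exp (z * u) * F u)
    (fun n u => (‖z‖ * |u|) ^ n / n.factorial * ‖F u‖)
    (fun n => ((by fun_prop : Continuous fun u : ℝ =>
      (u : ℂ) ^ n).aestronglyMeasurable.mul hmeas).const_mul _)
    (fun n => ae_of_all _ fun u => le_of_eq ?_)
    (ae_of_all _ fun u => (hsummable u).summable)
    ((hF ‖z‖).norm.congr (ae_of_all _ fun u => ?_))
    (ae_of_all _ fun u => ?_)
  · simpa only [integral_const_mul] using h
  · rw [norm_mul, norm_mul, norm_div, norm_pow, norm_pow, Complex.norm_real, Real.norm_eq_abs,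
      Complex.norm_natCast, mul_pow]
    ring
  · simp only [(hsummable u).tsum_eq, norm_mul, Complex.norm_real, Real.norm_eq_abs, Real.abs_exp]
  · simp_rw [Complex.exp_eq_exp_ℂ, ← mul_assoc]
    refine HasSum.mul_right _ ?_
    simpa only [mul_pow, div_mul_eq_mul_div] using NormedSpace.expSeries_div_hasSum_exp (z * u)

lemma ae_eq_zero_of_moments_eq_zero
    (hF : ∀ t : ℝ, Integrable fun u => (Real.exp (t * |u|) : ℂ) * F u)
    (h : ∀ n : ℕ, ∫ u : ℝ, (u : ℂ) ^ n * F u = 0) : F =ᵐ[volume] 0 := by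
  refine ae_eq_zero_of_fourier_eq_zero (integrable_of_integrable_exp_mul hF) (funext fun w => ?_)
  have hsum := hasSum_integral_pow_mul hF (-2 * Real.pi * w * Complex.I)
  simp only [h, mul_zero] at hsum
  rw [Real.fourier_real_eq_integral_exp_smul, Pi.zero_apply, ← hsum.unique hasSum_zero]
  congr 1 with u
  rw [smul_eq_mul]
  push_cast
  ring_nf

end Moments

section HermiteBasis

lemma integrable_exp_mul_gaussian_mul {α : ℝ} (hα : 0 < α) {G : ℝ → ℂ} (hG : MemLp G 2) (t : ℝ) :
    Integrable fun u => (Real.exp (t * |u|) : ℂ) * (gaussian hα u * G u) := by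
  have h := (((gaussian (half_pos hα)).memLp 2).integrable_mul hG).norm.const_mul
    (Real.exp (t ^ 2 / α))
  refine h.mono' (((by fun_prop : Continuous fun u : ℝ =>
    (Real.exp (t * |u|) : ℂ)).aestronglyMeasurable).mul
      ((gaussian hα).continuous.aestronglyMeasurable.mul hG.1)) (ae_of_all _ fun u => ?_)
  have hsq : t * |u| + -α * u ^ 2 / 2 ≤ t ^ 2 / α + -(α / 2) * u ^ 2 / 2 := by
    have hnonneg : 0 ≤ (t / α - |u| / 2) ^ 2 * α := by positivity
    have hexpand : (t / α - |u| / 2) ^ 2 * α = t ^ 2 / α - t * |u| + α * u ^ 2 / 4 := by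
      rw [← sq_abs u]
      field_simp
      ring
    linarith
  have hexp := Real.exp_le_exp.mpr hsq
  rw [Real.exp_add, Real.exp_add] at hexp
  simp only [Pi.mul_apply, gaussian_apply, norm_mul, Complex.norm_real, Real.norm_eq_abs,
    Real.abs_exp, ← mul_assoc]
  gcongr

variable {α : ℝ} (hα : 0 < α)

lemma position_mem_span_ladder {f : 𝓢(ℝ, ℂ)} (hf : f ∈ Submodule.span ℂ (Set.range (ladder hα))) :
    position f ∈ Submodule.span ℂ (Set.range (ladder hα)) := by
  have hmem (l : ℕ) : ladder hα l ∈ Submodule.span ℂ (Set.range (ladder hα)) :=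
    Submodule.subset_span ⟨l, rfl⟩
  suffices h : Submodule.span ℂ (Set.range (ladder hα)) ≤
      (Submodule.span ℂ (Set.range (ladder hα))).comap position.toLinearMap from h hf
  rw [Submodule.span_le]
  rintro _ ⟨l, rfl⟩
  simp only [SetLike.mem_coe, Submodule.mem_comap, ContinuousLinearMap.coe_coe]
  rw [position_eq _ hα.ne', ← ladder_succ, lowering_ladder]
  exact Submodule.smul_mem _ _ (add_mem (hmem _) (Submodule.smul_mem _ _ (hmem _)))

lemma iterate_position_apply (n : ℕ) (f : 𝓢(ℝ, ℂ)) (u : ℝ) :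
    (position^[n] f) u = (u : ℂ) ^ n * f u := by
  induction n with
  | zero => simp
  | succ n ih => rw [Function.iterate_succ_apply', position_apply, ih, pow_succ', mul_assoc]

lemma iterate_position_gaussian_mem_span_ladder (n : ℕ) :
    position^[n] (gaussian hα) ∈ Submodule.span ℂ (Set.range (ladder hα)) := by
  induction n with
  | zero => exact Submodule.subset_span ⟨0, rfl⟩
  | succ n ih =>
    rw [Function.iterate_succ_apply']
    exact position_mem_span_ladder hα ih

lemma eq_zero_of_inner_ladder_eq_zero {G : Lp ℂ 2 (volume : Measure ℝ)}
    (h : ∀ l, ⟪schwartzL2 (ladder hα l), G⟫_ℂ = 0) : G = 0 := by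
  have hspan : ∀ f ∈ Submodule.span ℂ (Set.range (ladder hα)), ⟪schwartzL2 f, G⟫_ℂ = 0 := by
    intro f hf
    induction hf using Submodule.span_induction with
    | mem f hf => obtain ⟨l, rfl⟩ := hf; exact h l
    | zero => simp
    | add f g _ _ hf hg => rw [map_add, inner_add_left, hf, hg, add_zero]
    | smul c f _ hf => rw [map_smul, inner_smul_left, hf, mul_zero]
  have hzero : (fun u => gaussian hα u * G u) =ᵐ[volume] 0 := by
    refine ae_eq_zero_of_moments_eq_zero (integrable_exp_mul_gaussian_mul hα (Lp.memLp G))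
      fun n => ?_
    rw [← hspan _ (iterate_position_gaussian_mem_span_ladder hα n), L2.inner_def]
    refine (integral_congr_ae ?_).symm
    filter_upwards [SchwartzMap.coeFn_toLp (position^[n] (gaussian hα) : 𝓢(ℝ, ℂ)) 2 volume]
      with u hu
    rw [schwartzL2, toLpCLM_apply, hu, RCLike.inner_apply', iterate_position_apply, map_mul,
      map_pow, Complex.conj_ofReal, gaussian_apply, Complex.conj_ofReal, mul_assoc]
  refine (Lp.eq_zero_iff_ae_eq_zero).mpr (hzero.mono fun u hu => ?_)
  exact (mul_eq_zero.mp hu).resolve_left (Complex.ofReal_ne_zero.mpr (Real.exp_ne_zero _))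

variable {lam : ℝ} (hlam : lam ≠ 0)

/-- The rescaled Hermite functions `h_{l,λ}` as an orthonormal basis of `L²(ℝ)`. -/
noncomputable def hermiteBasis : HilbertBasis ℕ ℂ (Lp ℂ 2 (volume : Measure ℝ)) :=
  HilbertBasis.mkOfOrthogonalEqBot (orthonormal_hermiteSchwartz hlam) <| by
    rw [Submodule.eq_bot_iff]
    intro G hG
    refine eq_zero_of_inner_ladder_eq_zero (α := 2 * Real.pi * |lam|) (by positivity) fun l => ?_
    have h := Submodule.mem_orthogonal _ _ |>.mp hG _ (Submodule.subset_span ⟨l, rfl⟩)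
    simp only [hermiteSchwartz, map_smul, inner_smul_left, Complex.conj_ofReal] at h
    refine (mul_eq_zero.mp h).resolve_left (Complex.ofReal_ne_zero.mpr fun hzero => ?_)
    simpa [hzero] using ladderNormalization_sq (α := 2 * Real.pi * |lam|) (by positivity) l

lemma hermiteBasis_apply (l : ℕ) : hermiteBasis hlam l = schwartzL2 (hermiteSchwartz hlam l) :=
  congrFun (HilbertBasis.coe_mkOfOrthogonalEqBot (orthonormal_hermiteSchwartz hlam) _) l

end HermiteBasis

/-! ### Vector fields in coordinates -/

section Coordinates

/-- The covering map `ℝ³ → M` given by the coordinates `(a, b, c)`. -/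
def coordProj (p : ℝ × ℝ × ℝ) : Nil := proj (Heis.coord.symm p)

lemma coordProj_surjective : Function.Surjective coordProj :=
  Quotient.mk_surjective.comp Heis.coord.symm.surjective

/-- The covector `x da + y db + z dc` on `ℝ³`, as a continuous linear function of `(x, y, z)`. -/
noncomputable def covector : ℂ × ℂ × ℂ →L[ℝ] (ℝ × ℝ × ℝ →L[ℝ] ℂ) :=
  let da := ContinuousLinearMap.fst ℝ ℝ (ℝ × ℝ)
  let db := ContinuousLinearMap.fst ℝ ℝ ℝ ∘L ContinuousLinearMap.snd ℝ ℝ (ℝ × ℝ)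
  let dc := ContinuousLinearMap.snd ℝ ℝ ℝ ∘L ContinuousLinearMap.snd ℝ ℝ (ℝ × ℝ)
  (ContinuousLinearMap.smulRightL ℝ (ℝ × ℝ × ℝ) ℂ da).coprod
    ((ContinuousLinearMap.smulRightL ℝ (ℝ × ℝ × ℝ) ℂ db).coprod
      (ContinuousLinearMap.smulRightL ℝ (ℝ × ℝ × ℝ) ℂ dc))

lemma covector_apply (w : ℂ × ℂ × ℂ) (v : ℝ × ℝ × ℝ) :
    covector w v = v.1 * w.1 + (v.2.1 * w.2.1 + v.2.2 * w.2.2) := by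
  simp [covector]

variable {F : Nil → ℂ} {L : ℝ × ℝ × ℝ →L[ℝ] ℂ} {p : ℝ × ℝ × ℝ}

lemma fieldA_coordProj (h : HasFDerivAt (F ∘ coordProj) L p) :
    fieldA F (coordProj p) = L (1, 0, 0) := by
  have hcurve : HasDerivAt (fun t : ℝ => p + t • ((1, 0, 0) : ℝ × ℝ × ℝ)) (1, 0, 0) 0 := by
    simpa using ((hasDerivAt_id (0 : ℝ)).smul_const ((1, 0, 0) : ℝ × ℝ × ℝ)).const_add p
  rw [← (h.comp_hasDerivAt_of_eq (0 : ℝ) hcurve (by simp)).deriv, fieldA]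
  congr 1 with t
  change F (proj (_ * _)) = F (proj _)
  congr 2
  ext <;> simp [Heis.coord]

lemma fieldB_coordProj (h : HasFDerivAt (F ∘ coordProj) L p) :
    fieldB F (coordProj p) = L (0, 1, p.1) := by
  have hcurve : HasDerivAt (fun t : ℝ => p + t • ((0, 1, p.1) : ℝ × ℝ × ℝ)) (0, 1, p.1) 0 := by
    simpa using ((hasDerivAt_id (0 : ℝ)).smul_const ((0, 1, p.1) : ℝ × ℝ × ℝ)).const_add p
  rw [← (h.comp_hasDerivAt_of_eq (0 : ℝ) hcurve (by simp)).deriv, fieldB]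
  congr 1 with t
  change F (proj (_ * _)) = F (proj _)
  congr 2
  ext <;> simp [Heis.coord, mul_comm]

lemma fieldA_const_smul (c : ℂ) (F : Nil → ℂ) : fieldA (c • F) = c • fieldA F :=
  funext fun _ => deriv_const_mul_field c

lemma fieldB_const_smul (c : ℂ) (F : Nil → ℂ) : fieldB (c • F) = c • fieldB F :=
  funext fun _ => deriv_const_mul_field c

end Coordinates

/-! ### The characters -/

section Characters

variable (ω : ℤ × ℤ)

lemma chi_coordProj (p : ℝ × ℝ × ℝ) : chi ω (coordProj p) =
    Complex.exp (2 * Real.pi * Complex.I * (ω.1 * p.1 + ω.2 * p.2.1)) := rfl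

lemma isSmooth_chi : IsSmooth (chi ω) := by
  change ContDiff ℝ _ fun p : ℝ × ℝ × ℝ =>
    Complex.exp (2 * Real.pi * Complex.I * (ω.1 * p.1 + ω.2 * p.2.1))
  have hofReal := Complex.ofRealCLM.contDiff (n := ((⊤ : ℕ∞) : WithTop ℕ∞))
  exact (contDiff_const.mul ((contDiff_const.mul (hofReal.comp contDiff_fst)).add
    (contDiff_const.mul (hofReal.comp (contDiff_fst.comp contDiff_snd))))).cexp

lemma hasFDerivAt_chi (p : ℝ × ℝ × ℝ) :
    HasFDerivAt (chi ω ∘ coordProj) (covector (2 * Real.pi * Complex.I * ω.1 * chi ω (coordProj p),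
      2 * Real.pi * Complex.I * ω.2 * chi ω (coordProj p), 0)) p := by
  have hexp : chi ω ∘ coordProj = fun p => Complex.exp
      (covector (2 * Real.pi * Complex.I * ω.1, 2 * Real.pi * Complex.I * ω.2, 0) p) := by
    funext p
    rw [Function.comp_apply, chi_coordProj, covector_apply]
    congr 1
    ring
  rw [← Function.comp_apply (f := chi ω), hexp]
  refine (ContinuousLinearMap.hasFDerivAt _).cexp.congr_fderiv (ContinuousLinearMap.ext fun v => ?_)
  simp only [smul_apply, covector_apply, smul_eq_mul]
  ring

lemma fieldA_chi : fieldA (chi ω) = (2 * Real.pi * Complex.I * ω.1) • chi ω := by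
  funext x
  obtain ⟨p, rfl⟩ := coordProj_surjective x
  simp [fieldA_coordProj (hasFDerivAt_chi ω p), covector_apply]

lemma fieldB_chi : fieldB (chi ω) = (2 * Real.pi * Complex.I * ω.2) • chi ω := by
  funext x
  obtain ⟨p, rfl⟩ := coordProj_surjective x
  simp [fieldB_coordProj (hasFDerivAt_chi ω p), covector_apply]

lemma subLaplacian_chi : subLaplacian (chi ω) =
    fun p => (((2 * Real.pi) ^ 2 * ((ω.1 : ℝ) ^ 2 + (ω.2 : ℝ) ^ 2) : ℝ) : ℂ) * chi ω p := by
  funext p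
  simp only [subLaplacian, fieldA_chi, fieldB_chi, fieldA_const_smul, fieldB_const_smul,
    Pi.smul_apply, smul_eq_mul]
  push_cast
  linear_combination (-(2 * Real.pi) ^ 2 * ((ω.1 : ℂ) ^ 2 + (ω.2 : ℂ) ^ 2) * chi ω p) *
    Complex.I_sq

end Characters

/-! ### The Berezin-Weil-Zak transform of a Schwartz function -/

section BWZ

lemma summable_inv_one_add_int_sq : Summable fun k : ℤ => (1 + (k : ℝ) ^ 2)⁻¹ := by
  refine Summable.of_norm_bounded_eventually (g := fun k : ℤ => 1 / (k : ℝ) ^ 2)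
    (Real.summable_one_div_int_pow.mpr one_lt_two) ?_
  filter_upwards [(Set.finite_singleton (0 : ℤ)).compl_mem_cofinite] with k hk
  have hpos : 0 < (k : ℝ) ^ 2 := sq_pos_of_ne_zero (Int.cast_ne_zero.mpr hk)
  rw [Real.norm_of_nonneg (by positivity), one_div]
  exact inv_anti₀ hpos (by linarith)

lemma norm_bwzTerm (lam q : ℤ) (h : ℝ → ℂ) (x : Heis) (k : ℤ) :
    ‖bwzTerm lam q h x k‖ = ‖h (k / lam + x.a)‖ := by
  have hchar : ‖Complex.exp (-(2 * Real.pi * Complex.I * q * (k / lam)))‖ = 1 := by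
    have := Complex.norm_exp_ofReal_mul_I (-(2 * Real.pi * q * (k / lam)))
    rw [← this]; push_cast; ring_nf
  have hphase : ‖Complex.exp (2 * Real.pi * Complex.I * (lam * x.c + k * x.b))‖ = 1 := by
    have := Complex.norm_exp_ofReal_mul_I (2 * Real.pi * (lam * x.c + k * x.b))
    rw [← this]; push_cast; ring_nf
  rw [bwzTerm, norm_mul, norm_mul, hchar, hphase, one_mul, one_mul]

lemma one_add_sq_le {lam a R : ℝ} (ha : |a| ≤ R) (u : ℝ) :
    1 + (lam * (u - a)) ^ 2 ≤ ((1 + |lam|) * (1 + R)) ^ 2 * (1 + |u|) ^ 2 := by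
  have hR : 0 ≤ R := (abs_nonneg a).trans ha
  have hdiff : |u - a| ≤ |u| + R := (abs_sub u a).trans (by gcongr)
  calc 1 + (lam * (u - a)) ^ 2 ≤ (1 + |lam| * |u - a|) ^ 2 := by
        rw [← sq_abs, abs_mul]
        nlinarith [mul_nonneg (abs_nonneg lam) (abs_nonneg (u - a))]
    _ ≤ (1 + |lam| * (|u| + R)) ^ 2 := by gcongr
    _ ≤ ((1 + |lam|) * (1 + R) * (1 + |u|)) ^ 2 := by
        gcongr
        have : 0 ≤ |u| + R + R * |u| + |lam| * (1 + R * |u|) := by positivity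
        linarith
    _ = _ := by rw [mul_pow _ (1 + |u|)]

variable {lam : ℤ} (hlam : lam ≠ 0) (q : ℤ) (f : 𝓢(ℝ, ℂ))

include hlam in
lemma exists_norm_bwzTerm_le (R : ℝ) : ∃ C, ∀ x : Heis, |x.a| ≤ R → ∀ k : ℤ,
    ‖bwzTerm lam q f x k‖ ≤ C * (1 + (k : ℝ) ^ 2)⁻¹ := by
  have hdecay (u : ℝ) := one_add_le_sup_seminorm_apply (𝕜 := ℂ) (m := (2, 0)) le_rfl le_rfl f u
  simp only [norm_iteratedFDeriv_zero, Real.norm_eq_abs] at hdecay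
  generalize (2 : ℝ) ^ 2 * _ = C at hdecay
  refine ⟨((1 + |(lam : ℝ)|) * (1 + R)) ^ 2 * C, fun x hx k => ?_⟩
  have hk := one_add_sq_le (lam := lam) hx (k / lam + x.a)
  rw [add_sub_cancel_right, mul_div_cancel₀ _ (Int.cast_ne_zero.mpr hlam)] at hk
  rw [norm_bwzTerm, ← div_eq_mul_inv, le_div_iff₀' (by positivity)]
  calc _ ≤ ((1 + |(lam : ℝ)|) * (1 + R)) ^ 2 * (1 + |k / lam + x.a|) ^ 2 * ‖f (k / lam + x.a)‖ := by
        gcongr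
    _ ≤ _ := by
        rw [mul_assoc]
        gcongr
        exact hdecay _

include hlam in
lemma summable_bwzTerm (x : Heis) : Summable (bwzTerm lam q f x) := by
  obtain ⟨C, hC⟩ := exists_norm_bwzTerm_le hlam q f |x.a|
  exact .of_norm_bounded (summable_inv_one_add_int_sq.mul_left C) (hC x le_rfl)

lemma bwz_coordProj (lam q : ℤ) (h : ℝ → ℂ) (p : ℝ × ℝ × ℝ) : bwz lam q h (coordProj p) =
    ((√|(lam : ℝ)| / (lam : ℝ) : ℝ) : ℂ) * ∑' k, bwzTerm lam q h (Heis.coord.symm p) k := rfl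

/-- The Berezin-Weil-Zak transform as a linear map on Schwartz functions. -/
noncomputable def bwzSchwartz : 𝓢(ℝ, ℂ) →ₗ[ℂ] (Nil → ℂ) where
  toFun f := bwz lam q f
  map_add' f g := by
    funext x
    obtain ⟨p, rfl⟩ := coordProj_surjective x
    rw [Pi.add_apply, bwz_coordProj, bwz_coordProj, bwz_coordProj, ← mul_add,
      ← (summable_bwzTerm hlam q f _).tsum_add (summable_bwzTerm hlam q g _)]
    simp only [bwzTerm, add_apply, mul_add]
  map_smul' c f := by
    funext x
    obtain ⟨p, rfl⟩ := coordProj_surjective x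
    simp only [Pi.smul_apply, bwz_coordProj, RingHom.id_apply, bwzTerm,
      smul_apply, smul_eq_mul, mul_left_comm _ c, tsum_mul_left]

lemma bwzSchwartz_apply : bwzSchwartz hlam q f = bwz lam q f := rfl

/-- The differential of the `k`-th term of the series in the coordinates `(a, b, c)`. The derivative
`∂_b` produces the factor `k = λ ((k/λ + a) - a)`. -/
noncomputable def bwzTermDifferential (lam q : ℤ) (f : 𝓢(ℝ, ℂ)) (p : ℝ × ℝ × ℝ) (k : ℤ) :
    ℂ × ℂ × ℂ :=
  (bwzTerm lam q (derivCLM ℂ ℂ f) (Heis.coord.symm p) k,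
    2 * Real.pi * Complex.I * lam * (bwzTerm lam q (position f) (Heis.coord.symm p) k -
      p.1 * bwzTerm lam q f (Heis.coord.symm p) k),
    2 * Real.pi * Complex.I * lam * bwzTerm lam q f (Heis.coord.symm p) k)

include hlam in
lemma hasFDerivAt_bwzTerm (k : ℤ) (p : ℝ × ℝ × ℝ) :
    HasFDerivAt (fun p => bwzTerm lam q f (Heis.coord.symm p) k)
      (covector (bwzTermDifferential lam q f p k)) p := by
  have hlam' : (lam : ℂ) ≠ 0 := Int.cast_ne_zero.mpr hlam
  have hexponent := (covector (0, 2 * Real.pi * Complex.I * k,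
    2 * Real.pi * Complex.I * lam)).hasFDerivAt (x := p)
  have harg := (f.hasDerivAt (k / lam + p.1)).hasFDerivAt.comp p
    ((hasFDerivAt_fst (𝕜 := ℝ) (p := p)).const_add (k / lam : ℝ))
  have hterm := (hexponent.cexp.const_mul
    (Complex.exp (-(2 * Real.pi * Complex.I * q * (k / lam))))).mul harg
  have hphase (p : ℝ × ℝ × ℝ) :
      covector (0, 2 * Real.pi * Complex.I * k, 2 * Real.pi * Complex.I * lam) p =
        2 * Real.pi * Complex.I * (lam * p.2.2 + k * p.2.1) := by
    rw [covector_apply]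
    ring
  simp only [hphase] at hterm
  refine hterm.congr_fderiv (ContinuousLinearMap.ext fun v => ?_)
  simp only [bwzTermDifferential, bwzTerm, Heis.coord, Equiv.coe_fn_symm_mk, derivCLM_apply,
    position_apply]
  generalize Complex.exp (-_) = E₁
  generalize Complex.exp _ = E₂
  simp only [covector_apply, Function.comp_apply, add_apply, smul_apply,
    ContinuousLinearMap.comp_apply, ContinuousLinearMap.coe_fst',
    ContinuousLinearMap.toSpanSingleton_apply, Complex.real_smul, smul_eq_mul, mul_zero, zero_add,
    Complex.ofReal_add, Complex.ofReal_div, Complex.ofReal_intCast]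
  field_simp
  ring

lemma norm_prod_mk_le {E F : Type*} [SeminormedAddCommGroup E] [SeminormedAddCommGroup F]
    (x : E) (y : F) : ‖(x, y)‖ ≤ ‖x‖ + ‖y‖ :=
  max_le (le_add_of_nonneg_right (norm_nonneg y)) (le_add_of_nonneg_left (norm_nonneg x))

include hlam in
lemma exists_norm_bwzTermDifferential_le (R : ℝ) : ∃ C, ∀ p : ℝ × ℝ × ℝ, |p.1| ≤ R → ∀ k : ℤ,
    ‖bwzTermDifferential lam q f p k‖ ≤ C * (1 + (k : ℝ) ^ 2)⁻¹ := by
  obtain ⟨C₀, h₀⟩ := exists_norm_bwzTerm_le hlam q f R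
  obtain ⟨C₁, h₁⟩ := exists_norm_bwzTerm_le hlam q (derivCLM ℂ ℂ f) R
  obtain ⟨C₂, h₂⟩ := exists_norm_bwzTerm_le hlam q (position f) R
  let w : ℂ := 2 * Real.pi * Complex.I * lam
  refine ⟨C₁ + (‖w‖ * (C₂ + R * C₀) + ‖w‖ * C₀), fun p hp k => ?_⟩
  have hR : 0 ≤ R := (abs_nonneg _).trans hp
  have ha : ‖(p.1 : ℂ)‖ ≤ R := by rwa [Complex.norm_real]
  calc ‖bwzTermDifferential lam q f p k‖
      ≤ ‖bwzTerm lam q (derivCLM ℂ ℂ f) (Heis.coord.symm p) k‖ +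
        (‖w‖ * (‖bwzTerm lam q (position f) (Heis.coord.symm p) k‖ +
          ‖(p.1 : ℂ)‖ * ‖bwzTerm lam q f (Heis.coord.symm p) k‖) +
        ‖w‖ * ‖bwzTerm lam q f (Heis.coord.symm p) k‖) := by
        refine (norm_prod_mk_le _ _).trans ?_
        gcongr
        refine (norm_prod_mk_le _ _).trans ?_
        rw [norm_mul w, norm_mul w, ← norm_mul (p.1 : ℂ)]
        gcongr
        exact norm_sub_le _ _
    _ ≤ C₁ * (1 + (k : ℝ) ^ 2)⁻¹ + (‖w‖ * (C₂ * (1 + (k : ℝ) ^ 2)⁻¹ +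
        R * (C₀ * (1 + (k : ℝ) ^ 2)⁻¹)) + ‖w‖ * (C₀ * (1 + (k : ℝ) ^ 2)⁻¹)) := by
        gcongr
        exacts [h₁ (Heis.coord.symm p) hp k, h₂ (Heis.coord.symm p) hp k,
          h₀ (Heis.coord.symm p) hp k, h₀ (Heis.coord.symm p) hp k]
    _ = _ := by ring

lemma hasFDerivAt_bwzSchwartz (p : ℝ × ℝ × ℝ) :
    HasFDerivAt (bwzSchwartz hlam q f ∘ coordProj)
      (covector (bwzSchwartz hlam q (derivCLM ℂ ℂ f) (coordProj p),
        2 * Real.pi * Complex.I * lam * (bwzSchwartz hlam q (position f) (coordProj p) -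
          p.1 * bwzSchwartz hlam q f (coordProj p)),
        2 * Real.pi * Complex.I * lam * bwzSchwartz hlam q f (coordProj p))) p := by
  let R : ℝ := |p.1| + 1
  obtain ⟨C, hC⟩ := exists_norm_bwzTermDifferential_le hlam q f R
  have hp : p ∈ Set.Ioo (-R) R ×ˢ (Set.univ : Set (ℝ × ℝ)) := ⟨abs_lt.mp (lt_add_one _), trivial⟩
  have hseries := hasFDerivAt_tsum_of_isPreconnected (𝕜 := ℝ)
    (u := fun k : ℤ => ‖covector‖ * (C * (1 + (k : ℝ) ^ 2)⁻¹))
    ((summable_inv_one_add_int_sq.mul_left _).mul_left _) (isOpen_Ioo.prod isOpen_univ)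
    (isPreconnected_Ioo.prod isPreconnected_univ) (fun k y _ => hasFDerivAt_bwzTerm hlam q f k y)
    (fun k y hy => (covector.le_opNorm _).trans
      (mul_le_mul_of_nonneg_left (hC y (abs_lt.mpr hy.1).le k) (norm_nonneg _)))
    hp (summable_bwzTerm hlam q f _) hp
  have hs₀ := (summable_bwzTerm hlam q f (Heis.coord.symm p)).hasSum
  have hs₁ := (summable_bwzTerm hlam q (derivCLM ℂ ℂ f) (Heis.coord.symm p)).hasSum
  have hs₂ := (summable_bwzTerm hlam q (position f) (Heis.coord.symm p)).hasSum
  have hsum := covector.hasSum (hs₁.prodMk (((hs₂.sub (hs₀.mul_left (p.1 : ℂ))).mul_left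
    (2 * Real.pi * Complex.I * lam)).prodMk (hs₀.mul_left (2 * Real.pi * Complex.I * lam))))
  simp only [bwzTermDifferential, hsum.tsum_eq] at hseries
  refine (hseries.const_mul _).congr_fderiv (ContinuousLinearMap.ext fun v => ?_)
  simp only [bwzSchwartz_apply, bwz_coordProj, smul_apply, covector_apply, smul_eq_mul]
  ring

lemma isSmooth_bwzSchwartz : IsSmooth (bwzSchwartz hlam q f) := by
  refine contDiff_infty.mpr fun n => ?_
  change ContDiff ℝ n (bwzSchwartz hlam q f ∘ coordProj)
  induction n generalizing f with
  | zero =>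
    exact contDiff_zero.mpr (continuous_iff_continuousAt.mpr
      fun p => (hasFDerivAt_bwzSchwartz hlam q f p).continuousAt)
  | succ n ih =>
    push_cast
    refine contDiff_succ_iff_fderiv.mpr
      ⟨fun p => (hasFDerivAt_bwzSchwartz hlam q f p).differentiableAt, by simp, ?_⟩
    rw [funext fun p => (hasFDerivAt_bwzSchwartz hlam q f p).fderiv]
    exact covector.contDiff.comp ((ih _).prodMk ((contDiff_const.mul ((ih _).sub
      ((Complex.ofRealCLM.contDiff.comp contDiff_fst).mul (ih f)))).prodMk
        (contDiff_const.mul (ih f))))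

lemma fieldA_bwzSchwartz :
    fieldA (bwzSchwartz hlam q f) = bwzSchwartz hlam q (derivCLM ℂ ℂ f) := by
  funext x
  obtain ⟨p, rfl⟩ := coordProj_surjective x
  simp [fieldA_coordProj (hasFDerivAt_bwzSchwartz hlam q f p), covector_apply]

lemma fieldB_bwzSchwartz : fieldB (bwzSchwartz hlam q f) =
    (2 * Real.pi * Complex.I * lam) • bwzSchwartz hlam q (position f) := by
  funext x
  obtain ⟨p, rfl⟩ := coordProj_surjective x
  rw [fieldB_coordProj (hasFDerivAt_bwzSchwartz hlam q f p), covector_apply]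
  simp only [Complex.ofReal_zero, zero_mul, Complex.ofReal_one, one_mul, zero_add, Pi.smul_apply,
    smul_eq_mul]
  ring

lemma subLaplacian_bwzSchwartz : subLaplacian (bwzSchwartz hlam q f) =
    bwzSchwartz hlam q (oscillator (2 * Real.pi * |(lam : ℝ)|) f) := by
  funext x
  have habs : ((|(lam : ℝ)| : ℝ) : ℂ) ^ 2 = (lam : ℂ) ^ 2 := by
    rw [← Complex.ofReal_pow, sq_abs, Complex.ofReal_pow, Complex.ofReal_intCast]
  simp only [subLaplacian, fieldA_bwzSchwartz, fieldB_bwzSchwartz, fieldB_const_smul, oscillator,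
    sub_apply, smul_apply, ContinuousLinearMap.comp_apply, map_sub, map_smul, Pi.sub_apply,
    Pi.smul_apply, smul_eq_mul]
  generalize bwzSchwartz hlam q (position (position f)) x = y
  push_cast
  linear_combination (-(2 * Real.pi) ^ 2 * y) * habs -
    ((2 * Real.pi) ^ 2 * (lam : ℂ) ^ 2 * y) * Complex.I_sq

end BWZ

section HermiteBWZ

variable {lam : ℤ} (hlam : lam ≠ 0)

lemma hFun_mk (q : ℤ) (l : ℕ) : hFun lam (QuotientAddGroup.mk q) l =
    bwzSchwartz hlam q (hermiteSchwartz (Int.cast_ne_zero.mpr hlam) l) := by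
  rw [bwzSchwartz_apply, funext (hermiteSchwartz_apply _ l)]
  rfl

include hlam

lemma summable_bwzTerm_hermiteScaled (q : ℤ) (l : ℕ) (x : Heis) :
    Summable (bwzTerm lam q (fun u => (hermiteScaled l lam u : ℂ)) x) := by
  rw [← funext (hermiteSchwartz_apply (Int.cast_ne_zero.mpr hlam) l)]
  exact summable_bwzTerm hlam q _ x

variable (q : ZModInt lam) (l : ℕ)

lemma isSmooth_hFun : IsSmooth (hFun lam q l) := by
  obtain ⟨q, rfl⟩ := QuotientAddGroup.mk_surjective q
  rw [hFun_mk hlam]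
  exact isSmooth_bwzSchwartz hlam q _

lemma subLaplacian_hFun : subLaplacian (hFun lam q l) = fun p =>
    ((2 * Real.pi * |(lam : ℝ)| * (2 * (l : ℝ) + 1) : ℝ) : ℂ) * hFun lam q l p := by
  obtain ⟨q, rfl⟩ := QuotientAddGroup.mk_surjective q
  rw [hFun_mk hlam, subLaplacian_bwzSchwartz, oscillator_hermiteSchwartz, map_smul]
  push_cast
  rfl

end HermiteBWZ

/-! ### The fundamental cube -/

section CubeMeasure

/-- The Lebesgue measure of `[0,1)`. -/
noncomputable def unitMeasure : Measure ℝ := volume.restrict (Set.Ico 0 1)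

instance : IsProbabilityMeasure unitMeasure := ⟨by simp [unitMeasure]⟩

/-- The Lebesgue measure of `[0,1)³`, the fundamental domain of `M` in coordinates. -/
noncomputable def cubeMeasure : Measure (ℝ × ℝ × ℝ) :=
  unitMeasure.prod (unitMeasure.prod unitMeasure)

instance : IsProbabilityMeasure cubeMeasure :=
  inferInstanceAs (IsProbabilityMeasure (unitMeasure.prod (unitMeasure.prod unitMeasure)))

lemma cubeMeasure_eq_restrict : cubeMeasure = volume.restrict
    (Set.Ico (0 : ℝ) 1 ×ˢ Set.Ico (0 : ℝ) 1 ×ˢ Set.Ico (0 : ℝ) 1) := by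
  simp only [cubeMeasure, unitMeasure, Measure.prod_restrict]
  rfl

lemma measurableSet_cube :
    MeasurableSet (Set.Ico (0 : ℝ) 1 ×ˢ Set.Ico (0 : ℝ) 1 ×ˢ Set.Ico (0 : ℝ) 1) :=
  measurableSet_Ico.prod (measurableSet_Ico.prod measurableSet_Ico)

lemma ae_mem_cube : ∀ᵐ p ∂cubeMeasure,
    p ∈ Set.Ico (0 : ℝ) 1 ×ˢ Set.Ico (0 : ℝ) 1 ×ˢ Set.Ico (0 : ℝ) 1 := by
  rw [cubeMeasure_eq_restrict]
  exact ae_restrict_mem measurableSet_cube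

lemma integral_cube_mul (F : ℝ × ℝ → ℂ) (G : ℝ → ℂ) :
    ∫ p, F (p.1, p.2.1) * G p.2.2 ∂cubeMeasure =
      (∫ z, F z ∂(unitMeasure.prod unitMeasure)) * ∫ c, G c ∂unitMeasure := by
  rw [← integral_prod_mul, cubeMeasure,
    ← (measurePreserving_prodAssoc unitMeasure unitMeasure unitMeasure).integral_comp
      MeasurableEquiv.prodAssoc.measurableEmbedding]
  rfl

lemma integral_unitMeasure_exp (n : ℤ) :
    ∫ c : ℝ, Complex.exp (2 * Real.pi * Complex.I * n * c) ∂unitMeasure =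
      if n = 0 then 1 else 0 := by
  split_ifs with h
  · simp [h]
  · have hn : (2 * Real.pi * Complex.I * n : ℂ) ≠ 0 :=
      mul_ne_zero Complex.two_pi_I_ne_zero (Int.cast_ne_zero.mpr h)
    have hperiod : Complex.exp (2 * Real.pi * Complex.I * n * (1 : ℝ)) = 1 :=
      Complex.exp_eq_one_iff.mpr ⟨n, by push_cast; ring⟩
    rw [unitMeasure, restrict_Ico_eq_restrict_Ioc, ← intervalIntegral.integral_of_le zero_le_one,
      integral_exp_mul_complex hn, hperiod]
    simp

end CubeMeasure

section NilMeasure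

lemma measurable_coord : Measurable (Heis.coord : Heis → ℝ × ℝ × ℝ) := comap_measurable _

lemma measurable_coord_symm : Measurable (Heis.coord.symm : ℝ × ℝ × ℝ → Heis) :=
  measurable_comap_iff.mpr (by simpa only [Equiv.self_comp_symm] using! measurable_id)

lemma measurable_proj : Measurable proj := fun _ hs => hs

lemma measurePreserving_coordProj : MeasurePreserving coordProj cubeMeasure nilMeasure := by
  refine ⟨measurable_proj.comp measurable_coord_symm, ?_⟩
  have hpreimage : fundDomain = Heis.coord ⁻¹'
      (Set.Ico (0 : ℝ) 1 ×ˢ Set.Ico (0 : ℝ) 1 ×ˢ Set.Ico (0 : ℝ) 1) := rfl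
  rw [nilMeasure, Heis.haar, hpreimage,
    Measure.restrict_map measurable_coord_symm (measurable_coord measurableSet_cube),
    Measure.map_map measurable_proj measurable_coord_symm, cubeMeasure_eq_restrict]
  rfl

instance : IsProbabilityMeasure nilMeasure := by
  rw [← measurePreserving_coordProj.map_eq]
  exact Measure.isProbabilityMeasure_map measurePreserving_coordProj.aemeasurable

lemma IsSmooth.measurable {F : Nil → ℂ} (hF : IsSmooth F) : Measurable F :=
  measurable_from_quotient.mpr (hF.continuous.measurable.comp measurable_coord)

/-- A function on `M` is determined by its values on the compact cube `[0,1]³`. -/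
lemma IsSmooth.memLp {F : Nil → ℂ} (hF : IsSmooth F) : MemLp F 2 nilMeasure := by
  obtain ⟨K, hK⟩ := ((isCompact_Icc (a := (0 : ℝ)) (b := 1)).prod
    ((isCompact_Icc (a := (0 : ℝ)) (b := 1)).prod (isCompact_Icc (a := (0 : ℝ)) (b := 1)))
    ).exists_bound_of_continuousOn hF.continuous.continuousOn
  refine MemLp.of_bound hF.measurable.aestronglyMeasurable K ?_
  rw [← measurePreserving_coordProj.map_eq, ae_map_iff measurePreserving_coordProj.aemeasurable
    (measurableSet_le hF.measurable.norm measurable_const)]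
  filter_upwards [ae_mem_cube] with p hp
  exact hK p ⟨Set.Ico_subset_Icc_self hp.1, Set.Ico_subset_Icc_self hp.2.1,
    Set.Ico_subset_Icc_self hp.2.2⟩

lemma inner_eq_integral_cube {f g : L2M} {F G : Nil → ℂ} (hF : f =ᵐ[nilMeasure] F)
    (hG : g =ᵐ[nilMeasure] G) :
    ⟪f, g⟫_ℂ = ∫ p, conj (F (coordProj p)) * G (coordProj p) ∂cubeMeasure := by
  have hinner : (fun x => ⟪f x, g x⟫_ℂ) =ᵐ[nilMeasure] fun x => conj (F x) * G x := by
    filter_upwards [hF, hG] with x hfx hgx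
    rw [hfx, hgx, RCLike.inner_apply']
  have hmeas := (L2.integrable_inner (𝕜 := ℂ) f g).aestronglyMeasurable.congr hinner
  rw [L2.inner_def, integral_congr_ae hinner]
  rw [← measurePreserving_coordProj.map_eq] at hmeas ⊢
  exact integral_map measurePreserving_coordProj.aemeasurable hmeas

lemma eLpNorm_eq_one_of_norm_toLp {F : Nil → ℂ} (hF : MemLp F 2 nilMeasure)
    (h : ‖hF.toLp F‖ = 1) : eLpNorm F 2 nilMeasure = 1 := by
  rwa [Lp.norm_toLp, ENNReal.toReal_eq_one_iff] at h

end NilMeasure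

/-! ### The central frequency -/

section CentralSubspaces

lemma inner_eq_zero_of_mem_L2sub {lam mu : ℤ} (h : lam ≠ mu) {f g : L2M} (hf : f ∈ L2sub lam)
    (hg : g ∈ L2sub mu) : ⟪f, g⟫_ℂ = 0 := by
  obtain ⟨F, hF, hF'⟩ := hf
  obtain ⟨G, hG, hG'⟩ := hg
  have hcentral (p : ℝ × ℝ × ℝ) : conj (F (coordProj p)) * G (coordProj p) =
      (conj (F (proj ⟨p.1, p.2.1, 0⟩)) * G (proj ⟨p.1, p.2.1, 0⟩)) *
        Complex.exp (2 * Real.pi * Complex.I * (mu - lam : ℤ) * p.2.2) := by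
    have hexp : Complex.exp (2 * Real.pi * Complex.I * (mu - lam : ℤ) * p.2.2) =
        conj (Complex.exp (2 * Real.pi * Complex.I * lam * p.2.2)) *
          Complex.exp (2 * Real.pi * Complex.I * mu * p.2.2) := by
      rw [← Complex.exp_conj, ← Complex.exp_add]
      congr 1
      simp only [map_mul, map_ofNat, Complex.conj_ofReal, Complex.conj_I, map_intCast]
      push_cast
      ring
    change conj (F (proj ⟨p.1, p.2.1, p.2.2⟩)) * G (proj ⟨p.1, p.2.1, p.2.2⟩) = _
    rw [hF' p.1 p.2.1 p.2.2, hG' p.1 p.2.1 p.2.2, map_mul, hexp]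
    ring
  simp_rw [inner_eq_integral_cube hF hG, hcentral]
  rw [integral_cube_mul (fun z => conj (F (proj ⟨z.1, z.2, 0⟩)) * G (proj ⟨z.1, z.2, 0⟩))
    (fun c => Complex.exp (2 * Real.pi * Complex.I * (mu - lam : ℤ) * c)),
    integral_unitMeasure_exp, if_neg (sub_ne_zero.mpr h.symm), mul_zero]

open Classical in
/-- The limit of a sequence, with the value `0` (rather than an arbitrary one, as for `limUnder`) if
there is none, so that it commutes with multiplication by nonzero constants for every sequence. -/
noncomputable def limitOrZero (u : ℕ → ℂ) : ℂ :=
  if ∃ z, Tendsto u atTop (nhds z) then limUnder atTop u else 0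

lemma limitOrZero_eq {u : ℕ → ℂ} {z : ℂ} (h : Tendsto u atTop (nhds z)) :
    limitOrZero u = z := by
  rw [limitOrZero, if_pos ⟨z, h⟩, h.limUnder_eq]

lemma limitOrZero_mul_const (u : ℕ → ℂ) {w : ℂ} (hw : w ≠ 0) :
    limitOrZero (fun i => u i * w) = limitOrZero u * w := by
  by_cases h : ∃ z, Tendsto u atTop (nhds z)
  · obtain ⟨z, hz⟩ := h
    rw [limitOrZero_eq hz, limitOrZero_eq (hz.mul_const w)]
  · have h' : ¬ ∃ z, Tendsto (fun i => u i * w) atTop (nhds z) := by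
      rintro ⟨z, hz⟩
      exact h ⟨z * w⁻¹, (hz.mul_const w⁻¹).congr fun i => mul_inv_cancel_right₀ hw _⟩
    rw [limitOrZero, limitOrZero, if_neg h, if_neg h', zero_mul]

lemma isClosed_L2sub (lam : ℤ) : IsClosed (L2sub lam : Set L2M) := by
  refine isClosed_of_closure_subset fun f hf => ?_
  obtain ⟨u, hu, hlim⟩ := mem_closure_iff_seq_limit.mp hf
  choose F hF hF' using hu
  obtain ⟨ns, -, hns⟩ := (tendstoInMeasure_of_tendsto_Lp hlim).exists_seq_tendsto_ae
  refine ⟨fun x => limitOrZero fun i => F (ns i) x, ?_, fun a b c => ?_⟩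
  · have hall : ∀ᵐ x ∂nilMeasure, ∀ i, u (ns i) x = F (ns i) x := ae_all_iff.mpr fun i => hF _
    filter_upwards [hns, hall] with x hx hx'
    exact (limitOrZero_eq (by simpa only [hx'] using hx)).symm
  · simp only [fun i => hF' (ns i) a b c]
    exact limitOrZero_mul_const _ (Complex.exp_ne_zero _)

instance (lam : ℤ) : CompleteSpace (L2sub lam) := (isClosed_L2sub lam).completeSpace_coe

lemma mem_L2sub_of_ae_eq_chi {ω : ℤ × ℤ} {f : L2M} (h : f =ᵐ[nilMeasure] chi ω) : f ∈ L2sub 0 :=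
  ⟨chi ω, h, fun a b c => by simp [chi, descend, proj]⟩

lemma mem_L2sub_of_ae_eq_bwz {lam q : ℤ} {h : ℝ → ℂ} {f : L2M} (hf : f =ᵐ[nilMeasure] bwz lam q h) :
    f ∈ L2sub lam := by
  refine ⟨bwz lam q h, hf, fun a b c => ?_⟩
  have hterm (k : ℤ) : bwzTerm lam q h ⟨a, b, c⟩ k =
      bwzTerm lam q h ⟨a, b, 0⟩ k * Complex.exp (2 * Real.pi * Complex.I * lam * c) := by
    have hexp : Complex.exp (2 * Real.pi * Complex.I * (lam * c + k * b)) =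
        Complex.exp (2 * Real.pi * Complex.I * (lam * (0 : ℝ) + k * b)) *
          Complex.exp (2 * Real.pi * Complex.I * lam * c) := by
      rw [← Complex.exp_add]
      congr 1
      push_cast
      ring
    rw [bwzTerm, bwzTerm, hexp]
    ring
  refine (bwz_coordProj lam q h (a, b, c)).trans (Eq.trans ?_ (congrArg (· * _)
    (bwz_coordProj lam q h (a, b, 0)).symm))
  simp only [Heis.coord, Equiv.coe_fn_symm_mk, hterm, tsum_mul_right, mul_assoc]

end CentralSubspaces

/-! ### Fourier series on the cube -/

section CubeCharacters

/-- The character `(a, b, c) ↦ e^{2πi(na + kb + lc)}` of `ℝ³`, which has period `1` in each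
coordinate. -/
noncomputable def cubeChar (n k l : ℤ) (p : ℝ × ℝ × ℝ) : ℂ :=
  Complex.exp (2 * Real.pi * Complex.I * (n * p.1 + k * p.2.1 + l * p.2.2))

variable (n k l : ℤ)

lemma continuous_cubeChar : Continuous (cubeChar n k l) := by
  unfold cubeChar
  fun_prop

lemma norm_cubeChar (p : ℝ × ℝ × ℝ) : ‖cubeChar n k l p‖ = 1 := by
  rw [cubeChar, ← Complex.norm_exp_ofReal_mul_I (2 * Real.pi * (n * p.1 + k * p.2.1 + l * p.2.2))]
  push_cast
  ring_nf

lemma conj_cubeChar (p : ℝ × ℝ × ℝ) : conj (cubeChar n k l p) = cubeChar (-n) (-k) (-l) p := by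
  rw [cubeChar, cubeChar, ← Complex.exp_conj]
  congr 1
  simp only [map_mul, map_add, map_ofNat, Complex.conj_ofReal, Complex.conj_I, map_intCast]
  push_cast
  ring

lemma cubeChar_mul (n' k' l' : ℤ) (p : ℝ × ℝ × ℝ) :
    cubeChar n k l p * cubeChar n' k' l' p = cubeChar (n + n') (k + k') (l + l') p := by
  rw [cubeChar, cubeChar, cubeChar, ← Complex.exp_add]
  congr 1
  push_cast
  ring

lemma integral_mul_cubeChar (φ : ℝ → ℂ) : ∫ p, φ p.1 * cubeChar 0 k l p ∂cubeMeasure =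
    if k = 0 ∧ l = 0 then ∫ a, φ a ∂unitMeasure else 0 := by
  have hfactor (p : ℝ × ℝ × ℝ) : φ p.1 * cubeChar 0 k l p =
      (φ p.1 * Complex.exp (2 * Real.pi * Complex.I * k * p.2.1)) *
        Complex.exp (2 * Real.pi * Complex.I * l * p.2.2) := by
    rw [mul_assoc, ← Complex.exp_add, cubeChar]
    congr 2
    push_cast
    ring
  simp_rw [hfactor]
  rw [integral_cube_mul (fun z => φ z.1 * Complex.exp (2 * Real.pi * Complex.I * k * z.2))
    (fun c => Complex.exp (2 * Real.pi * Complex.I * l * c)),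
    integral_prod_mul φ (fun b : ℝ => Complex.exp (2 * Real.pi * Complex.I * k * b)),
    integral_unitMeasure_exp, integral_unitMeasure_exp]
  split_ifs <;> simp_all

lemma cubeChar_eq_exp_mul (p : ℝ × ℝ × ℝ) : cubeChar n k l p =
    Complex.exp (2 * Real.pi * Complex.I * n * p.1) * cubeChar 0 k l p := by
  rw [cubeChar, cubeChar, ← Complex.exp_add]
  congr 1
  push_cast
  ring

lemma integral_cubeChar : ∫ p, cubeChar n k l p ∂cubeMeasure =
    if n = 0 ∧ k = 0 ∧ l = 0 then 1 else 0 := by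
  simp_rw [cubeChar_eq_exp_mul n]
  rw [integral_mul_cubeChar k l (fun a => Complex.exp (2 * Real.pi * Complex.I * n * a)),
    integral_unitMeasure_exp, ← ite_and]
  exact if_congr and_comm rfl rfl

end CubeCharacters

section Torus

/-- The circle is normalised to have total length `1`, as for `UnitAddTorus.mFourierBasis`. -/
noncomputable local instance : MeasureSpace UnitAddCircle := ⟨AddCircle.haarAddCircle⟩

local instance : IsProbabilityMeasure (volume : Measure UnitAddCircle) :=
  inferInstanceAs (IsProbabilityMeasure AddCircle.haarAddCircle)

/-- The projection of `ℝ³` onto the torus `(ℝ/ℤ)³`. -/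
noncomputable def torusMk (p : ℝ × ℝ × ℝ) : UnitAddTorus (Fin 3) :=
  ![(p.1 : UnitAddCircle), (p.2.1 : UnitAddCircle), (p.2.2 : UnitAddCircle)]

/-- The representative in `[0,1)` of a point of the circle. -/
noncomputable def unitRep (t : UnitAddCircle) : ℝ := AddCircle.equivIco (1 : ℝ) 0 t

/-- The representative in `[0,1)³` of a point of the torus. -/
noncomputable def torusRep (t : UnitAddTorus (Fin 3)) : ℝ × ℝ × ℝ :=
  (unitRep (t 0), unitRep (t 1), unitRep (t 2))

lemma unitRep_coe {x : ℝ} (hx : x ∈ Set.Ico (0 : ℝ) 1) : unitRep (x : UnitAddCircle) = x := by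
  rw [unitRep, AddCircle.coe_equivIco_mk_apply]
  simpa only [div_one, mul_one] using Int.fract_eq_self.mpr hx

lemma torusRep_torusMk {p : ℝ × ℝ × ℝ}
    (hp : p ∈ Set.Ico (0 : ℝ) 1 ×ˢ Set.Ico (0 : ℝ) 1 ×ˢ Set.Ico (0 : ℝ) 1) :
    torusRep (torusMk p) = p :=
  Prod.ext (unitRep_coe hp.1) (Prod.ext (unitRep_coe hp.2.1) (unitRep_coe hp.2.2))

lemma measurable_torusRep : Measurable torusRep := by
  have hunit : Measurable unitRep :=
    measurable_subtype_coe.comp (AddCircle.measurableEquivIco (1 : ℝ) 0).measurable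
  have hcoord (i : Fin 3) : Measurable fun t : UnitAddTorus (Fin 3) => unitRep (t i) :=
    hunit.comp (measurable_pi_apply i)
  exact (hcoord 0).prodMk ((hcoord 1).prodMk (hcoord 2))

lemma measurePreserving_unitMeasure_coe :
    MeasurePreserving (fun x : ℝ => (x : UnitAddCircle)) unitMeasure volume := by
  have hvolume : (AddCircle.measureSpace (1 : ℝ)).volume = AddCircle.haarAddCircle := by
    rw [AddCircle.volume_eq_smul_haarAddCircle, ENNReal.ofReal_one, one_smul]
  have h := UnitAddCircle.measurePreserving_mk 0
  rwa [zero_add, ← restrict_Ico_eq_restrict_Ioc, hvolume] at h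

lemma measurePreserving_torusMk : MeasurePreserving torusMk cubeMeasure volume := by
  have hcoe := measurePreserving_unitMeasure_coe
  have hmeas : Measurable torusMk := by
    refine measurable_pi_iff.mpr fun i => ?_
    fin_cases i
    · exact hcoe.measurable.comp measurable_fst
    · exact hcoe.measurable.comp (measurable_fst.comp measurable_snd)
    · exact hcoe.measurable.comp (measurable_snd.comp measurable_snd)
  refine ⟨hmeas, (Measure.pi_eq fun s hs => ?_).symm⟩
  have hpreimage : torusMk ⁻¹' Set.univ.pi s = ((fun x : ℝ => (x : UnitAddCircle)) ⁻¹' s 0) ×ˢ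
      ((fun x : ℝ => (x : UnitAddCircle)) ⁻¹' s 1) ×ˢ
        ((fun x : ℝ => (x : UnitAddCircle)) ⁻¹' s 2) := by
    ext p
    simp [torusMk, Set.mem_pi, Fin.forall_fin_succ]
  rw [Measure.map_apply hmeas (MeasurableSet.univ_pi hs), hpreimage, cubeMeasure,
    Measure.prod_prod, Measure.prod_prod, hcoe.measure_preimage (hs 0).nullMeasurableSet,
    hcoe.measure_preimage (hs 1).nullMeasurableSet,
    hcoe.measure_preimage (hs 2).nullMeasurableSet, Fin.prod_univ_three, mul_assoc]

lemma measurePreserving_torusRep : MeasurePreserving torusRep volume cubeMeasure := by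
  refine ⟨measurable_torusRep, ?_⟩
  have hid : torusRep ∘ torusMk =ᵐ[cubeMeasure] id := by
    filter_upwards [ae_mem_cube] with p hp using torusRep_torusMk hp
  rw [← measurePreserving_torusMk.map_eq,
    Measure.map_map measurable_torusRep measurePreserving_torusMk.measurable,
    Measure.map_congr hid, Measure.map_id]

lemma mFourier_torusMk (i : Fin 3 → ℤ) (p : ℝ × ℝ × ℝ) :
    UnitAddTorus.mFourier i (torusMk p) = cubeChar (i 0) (i 1) (i 2) p := by
  simp only [UnitAddTorus.mFourier, ContinuousMap.coe_mk, Fin.prod_univ_three, torusMk,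
    Matrix.cons_val, fourier_coe_apply, ← Complex.exp_add, cubeChar, Complex.ofReal_one, div_one]
  ring_nf

lemma mFourierCoeff_comp_torusRep {g : ℝ × ℝ × ℝ → ℂ} (hg : AEStronglyMeasurable g cubeMeasure)
    (i : Fin 3 → ℤ) : UnitAddTorus.mFourierCoeff (g ∘ torusRep) i =
      ∫ p, conj (cubeChar (i 0) (i 1) (i 2) p) * g p ∂cubeMeasure := by
  have hmeas : AEStronglyMeasurable
      (fun t => UnitAddTorus.mFourier (-i) t • (g ∘ torusRep) t) volume :=
    (UnitAddTorus.mFourier (-i)).continuous.aestronglyMeasurable.smul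
      (hg.comp_measurePreserving measurePreserving_torusRep)
  rw [UnitAddTorus.mFourierCoeff]
  rw [← measurePreserving_torusMk.map_eq] at hmeas ⊢
  rw [integral_map measurePreserving_torusMk.aemeasurable hmeas]
  refine integral_congr_ae ?_
  filter_upwards [ae_mem_cube] with p hp
  rw [mFourier_torusMk, Function.comp_apply, torusRep_torusMk hp, conj_cubeChar, smul_eq_mul]
  rfl

lemma ae_eq_zero_of_integral_conj_cubeChar_mul {g : ℝ × ℝ × ℝ → ℂ} (hg : MemLp g 2 cubeMeasure)
    (h : ∀ n k l, ∫ p, conj (cubeChar n k l p) * g p ∂cubeMeasure = 0) :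
    g =ᵐ[cubeMeasure] 0 := by
  have hrep : MemLp (g ∘ torusRep) 2 (volume : Measure (UnitAddTorus (Fin 3))) :=
    hg.comp_measurePreserving measurePreserving_torusRep
  have hzero : hrep.toLp _ = 0 := by
    refine (UnitAddTorus.mFourierBasis (d := Fin 3)).repr.injective (lp.ext (funext fun i => ?_))
    have hae : UnitAddTorus.mFourierCoeff (hrep.toLp _ : UnitAddTorus (Fin 3) → ℂ) i =
        UnitAddTorus.mFourierCoeff (g ∘ torusRep) i :=
      integral_congr_ae (hrep.coeFn_toLp.mono fun t ht => by simp only [ht])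
    rw [UnitAddTorus.mFourierBasis_repr, hae,
      mFourierCoeff_comp_torusRep hg.aestronglyMeasurable, h, map_zero]
    rfl
  have hcomp := measurePreserving_torusMk.quasiMeasurePreserving.ae_eq_comp
    (hrep.coeFn_toLp.symm.trans (hzero ▸ Lp.coeFn_zero _ _ _))
  filter_upwards [hcomp, ae_mem_cube] with p hp hp'
  simpa only [Function.comp_apply, torusRep_torusMk hp', Pi.zero_apply] using hp

end Torus

section Characters

/-- The class of `χ_ω` in `L²(M)`. -/
noncomputable def chiLp (ω : ℤ × ℤ) : L2M := (isSmooth_chi ω).memLp.toLp (chi ω)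

lemma coeFn_chiLp (ω : ℤ × ℤ) : chiLp ω =ᵐ[nilMeasure] chi ω := MemLp.coeFn_toLp _

lemma chi_coordProj_eq_cubeChar (ω : ℤ × ℤ) (p : ℝ × ℝ × ℝ) :
    chi ω (coordProj p) = cubeChar ω.1 ω.2 0 p := by
  rw [chi_coordProj, cubeChar, Int.cast_zero, zero_mul, add_zero]

lemma orthonormal_chiLp : Orthonormal ℂ chiLp := by
  refine orthonormal_iff_ite.mpr fun ω ω' => ?_
  rw [inner_eq_integral_cube (coeFn_chiLp ω) (coeFn_chiLp ω')]
  simp only [chi_coordProj_eq_cubeChar, conj_cubeChar, cubeChar_mul, integral_cubeChar,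
    Prod.ext_iff, neg_add_eq_zero, neg_zero, add_zero, and_true]

end Characters

/-! ### Inner products of Berezin-Weil-Zak transforms -/

section Residues

/-- The character `j ↦ e^{2πij/λ}` of `ℤ/λℤ`, as a function on `ℤ`. -/
noncomputable def residueChar (lam j : ℤ) : ℂ := Complex.exp (2 * Real.pi * Complex.I * (j / lam))

lemma residueChar_add (lam j k : ℤ) :
    residueChar lam (j + k) = residueChar lam j * residueChar lam k := by
  rw [residueChar, residueChar, residueChar, ← Complex.exp_add]
  congr 1
  push_cast
  ring

lemma conj_residueChar (lam j : ℤ) : conj (residueChar lam j) = residueChar lam (-j) := by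
  rw [residueChar, residueChar, ← Complex.exp_conj]
  congr 1
  simp only [map_mul, map_div₀, map_ofNat, Complex.conj_ofReal, Complex.conj_I, map_intCast]
  push_cast
  ring

lemma residueChar_mul_natCast (lam j : ℤ) (r : ℕ) :
    residueChar lam (j * r) = residueChar lam j ^ r := by
  rw [residueChar, residueChar, ← Complex.exp_nat_mul]
  congr 1
  push_cast
  ring

variable {lam : ℤ} (hlam : lam ≠ 0) (j : ℤ)

include hlam

lemma residueChar_eq_one_iff : residueChar lam j = 1 ↔ lam ∣ j := by
  have hlam' : (lam : ℂ) ≠ 0 := Int.cast_ne_zero.mpr hlam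
  rw [residueChar, Complex.exp_eq_one_iff]
  refine exists_congr fun n => ?_
  rw [mul_comm (n : ℂ), mul_right_inj' Complex.two_pi_I_ne_zero, div_eq_iff hlam', mul_comm]
  norm_cast

lemma sum_residueChar : ∑ r ∈ Finset.range lam.natAbs, residueChar lam (j * r) =
    if lam ∣ j then (lam.natAbs : ℂ) else 0 := by
  simp_rw [residueChar_mul_natCast]
  split_ifs with h
  · simp [(residueChar_eq_one_iff hlam j).mpr h]
  · have hroot : residueChar lam j ^ lam.natAbs = 1 := by
      rw [← residueChar_mul_natCast, residueChar_eq_one_iff hlam]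
      exact Int.dvd_natAbs_self.mul_left j
    rw [geom_sum_eq (mt (residueChar_eq_one_iff hlam j).mp h), hroot, sub_self, zero_div]

lemma hasSum_integral_unitMeasure_translate {φ : ℝ → ℂ} (hφ : Integrable φ) (x : ℝ) :
    HasSum (fun m : ℤ => ∫ a, φ (x + m * lam.natAbs / lam + a) ∂unitMeasure) (∫ u, φ u) := by
  have hsum := (hφ.comp_add_left x).hasSum_intervalIntegral_comp_add_int
  rw [integral_add_left_eq_self φ x] at hsum
  simp only [intervalIntegral.integral_of_le zero_le_one, ← restrict_Ico_eq_restrict_Ioc] at hsum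
  rcases hlam.lt_or_gt with h | h
  · have hratio : (lam.natAbs / lam : ℝ) = -1 := by
      rw [Nat.cast_natAbs, Int.cast_abs, abs_of_neg (Int.cast_lt_zero.mpr h)]
      exact neg_div_self (Int.cast_ne_zero.mpr hlam)
    rw [← (Equiv.neg ℤ).hasSum_iff] at hsum
    refine hsum.congr_fun fun m => integral_congr_ae (ae_of_all _ fun a => congrArg φ ?_)
    rw [mul_div_assoc, hratio, Equiv.neg_apply, Int.cast_neg]
    ring
  · have hratio : (lam.natAbs / lam : ℝ) = 1 := by
      rw [Nat.cast_natAbs, Int.cast_abs, abs_of_pos (Int.cast_pos.mpr h)]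
      exact div_self (Int.cast_ne_zero.mpr hlam)
    refine hsum.congr_fun fun m => integral_congr_ae (ae_of_all _ fun a => congrArg φ ?_)
    rw [mul_div_assoc, hratio]
    ring

/-- Each residue class modulo `λ` contributes the whole integral of `φ`, weighted by the value of
the character on it. -/
lemma hasSum_residueChar_mul_integral {φ : ℝ → ℂ} (hφ : Integrable φ) {s : ℂ}
    (hs : HasSum (fun k : ℤ => residueChar lam (j * k) * ∫ a, φ (k / lam + a) ∂unitMeasure) s) :
    s = if lam ∣ j then lam.natAbs * ∫ u, φ u else 0 := by
  have : NeZero lam.natAbs := ⟨Int.natAbs_ne_zero.mpr hlam⟩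
  have hprod := (((Equiv.prodComm _ _).trans (Int.divModEquiv lam.natAbs).symm).hasSum_iff).mpr hs
  have hfiber (r : Fin lam.natAbs) : HasSum (fun m : ℤ => residueChar lam (j * r) *
      ∫ a, φ (r / lam + m * lam.natAbs / lam + a) ∂unitMeasure)
      (residueChar lam (j * r) * ∫ u, φ u) :=
    (hasSum_integral_unitMeasure_translate hlam hφ _).mul_left _
  have hclasses := hprod.prod_fiberwise fun r => (hfiber r).congr_fun fun m => ?_
  · rw [hclasses.unique (hasSum_fintype _), ← Finset.sum_mul,
      Fin.sum_univ_eq_sum_range (fun r => residueChar lam (j * r)), sum_residueChar hlam, ite_mul,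
      zero_mul]
  · have hchar : residueChar lam (j * (m * lam.natAbs + r)) = residueChar lam (j * r) := by
      rw [mul_add, residueChar_add, (residueChar_eq_one_iff hlam _).mpr, one_mul]
      exact (Int.dvd_natAbs_self.mul_left m).mul_left j
    simp only [Function.comp_apply, Equiv.trans_apply, Equiv.prodComm_apply, Prod.swap_prod_mk,
      Int.divModEquiv_symm_apply, hchar, Int.cast_add, Int.cast_mul, Int.cast_natCast,
      add_comm _ (r : ℝ), add_div]

end Residues

section InnerBWZ

variable {lam : ℤ} (hlam : lam ≠ 0) (q q' : ℤ) (f f' : 𝓢(ℝ, ℂ))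

lemma bwzTerm_coord_symm (lam q : ℤ) (h : ℝ → ℂ) (p : ℝ × ℝ × ℝ) (k : ℤ) :
    bwzTerm lam q h (Heis.coord.symm p) k =
      residueChar lam (-(q * k)) * (h (k / lam + p.1) * cubeChar 0 k lam p) := by
  rw [bwzTerm, residueChar, cubeChar, mul_comm (h _), ← mul_assoc]
  congr 3
  · push_cast
    ring
  · simp only [Heis.coord, Equiv.coe_fn_symm_mk, Int.cast_zero]
    ring

lemma integral_conj_bwzTerm_mul_bwzTerm (lam q q' : ℤ) (h h' : ℝ → ℂ) (k k' : ℤ) :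
    ∫ p, conj (bwzTerm lam q h (Heis.coord.symm p) k) *
      bwzTerm lam q' h' (Heis.coord.symm p) k' ∂cubeMeasure =
    if k = k' then residueChar lam ((q - q') * k) *
      ∫ a, conj (h (k / lam + a)) * h' (k / lam + a) ∂unitMeasure else 0 := by
  have hphase (p : ℝ × ℝ × ℝ) : conj (bwzTerm lam q h (Heis.coord.symm p) k) *
      bwzTerm lam q' h' (Heis.coord.symm p) k' = residueChar lam (q * k - q' * k') *
        ((conj (h (k / lam + p.1)) * h' (k' / lam + p.1)) * cubeChar 0 (k' - k) 0 p) := by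
    have hchar := residueChar_add lam (q * k) (-(q' * k'))
    have hcube := cubeChar_mul 0 (-k) (-lam) 0 k' lam p
    simp only [bwzTerm_coord_symm, map_mul, conj_residueChar, conj_cubeChar, neg_neg, neg_zero,
      sub_eq_neg_add, neg_add_cancel, zero_add] at hchar hcube ⊢
    rw [add_comm (-(q' * k')), hchar, ← hcube]
    ring
  simp_rw [hphase]
  rw [integral_const_mul, integral_mul_cubeChar (k' - k) 0
    (fun a => conj (h (k / lam + a)) * h' (k' / lam + a))]
  rcases eq_or_ne k k' with rfl | hne
  · simp [sub_mul]
  · rw [if_neg (by simpa [sub_eq_zero] using hne.symm), if_neg hne, mul_zero]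

include hlam in
lemma continuous_bwzTerm (k : ℤ) :
    Continuous fun p => bwzTerm lam q f (Heis.coord.symm p) k :=
  continuous_iff_continuousAt.mpr fun p => (hasFDerivAt_bwzTerm hlam q f k p).continuousAt

lemma hasSum_integral_mul_bwzTerm {F : ℝ × ℝ × ℝ → ℂ} (hF : Integrable F cubeMeasure) :
    HasSum (fun k => ((√|(lam : ℝ)| / lam : ℝ) : ℂ) *
        ∫ p, F p * bwzTerm lam q f (Heis.coord.symm p) k ∂cubeMeasure)
      (∫ p, F p * bwzSchwartz hlam q f (coordProj p) ∂cubeMeasure) := by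
  obtain ⟨C, hC⟩ := exists_norm_bwzTerm_le hlam q f 1
  simp only [bwzSchwartz_apply, bwz_coordProj, mul_left_comm (F _), integral_const_mul]
  refine HasSum.mul_left _ (hasSum_integral_of_dominated_convergence
    (fun k p => ‖F p‖ * (C * (1 + (k : ℝ) ^ 2)⁻¹))
    (fun k => hF.aestronglyMeasurable.mul (continuous_bwzTerm hlam q f k).aestronglyMeasurable)
    (fun k => ?_) (ae_of_all _ fun p => (summable_inv_one_add_int_sq.mul_left C).mul_left _) ?_
    (ae_of_all _ fun p => (summable_bwzTerm hlam q f _).hasSum.mul_left _))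
  · filter_upwards [ae_mem_cube] with p hp
    rw [norm_mul]
    exact mul_le_mul_of_nonneg_left
      (hC _ (abs_le.mpr ⟨neg_one_lt_zero.le.trans hp.1.1, hp.1.2.le⟩) k) (norm_nonneg _)
  · simp only [tsum_mul_left]
    exact hF.norm.mul_const _

lemma integral_conj_bwzTerm_mul_bwzSchwartz (k : ℤ) :
    ∫ p, conj (bwzTerm lam q' f' (Heis.coord.symm p) k) *
      bwzSchwartz hlam q f (coordProj p) ∂cubeMeasure =
    ((√|(lam : ℝ)| / lam : ℝ) : ℂ) * (residueChar lam ((q' - q) * k) *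
      ∫ a, conj (f' (k / lam + a)) * f (k / lam + a) ∂unitMeasure) := by
  obtain ⟨C, hC⟩ := exists_norm_bwzTerm_le hlam q' f' 1
  have hint : Integrable (fun p => conj (bwzTerm lam q' f' (Heis.coord.symm p) k)) cubeMeasure := by
    refine Integrable.of_bound (Complex.continuous_conj.comp
      (continuous_bwzTerm hlam q' f' k)).aestronglyMeasurable (C * (1 + (k : ℝ) ^ 2)⁻¹) ?_
    filter_upwards [ae_mem_cube] with p hp
    rw [RCLike.norm_conj]
    exact hC _ (abs_le.mpr ⟨neg_one_lt_zero.le.trans hp.1.1, hp.1.2.le⟩) k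
  refine (hasSum_integral_mul_bwzTerm hlam q f hint).unique ?_
  simp only [integral_conj_bwzTerm_mul_bwzTerm]
  convert hasSum_ite_eq k _ using 2 with k'
  rcases eq_or_ne k' k with rfl | hne
  · simp
  · rw [if_neg hne.symm, if_neg hne, mul_zero]

/-- The class of `BWZ_{λ,q} f` in `L²(M)`, for `f` a Schwartz function. -/
noncomputable def bwzL2 : 𝓢(ℝ, ℂ) →ₗ[ℂ] L2M where
  toFun f := (isSmooth_bwzSchwartz hlam q f).memLp.toLp (bwzSchwartz hlam q f)
  map_add' f g := by simp only [map_add]; rfl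
  map_smul' z f := by simp only [map_smul]; rfl

lemma coeFn_bwzL2 : bwzL2 hlam q f =ᵐ[nilMeasure] bwzSchwartz hlam q f :=
  MemLp.coeFn_toLp (isSmooth_bwzSchwartz hlam q f).memLp

include hlam in
lemma natAbs_mul_bwzFactor_sq : (lam.natAbs : ℂ) *
    (((√|(lam : ℝ)| / lam : ℝ) : ℂ) * ((√|(lam : ℝ)| / lam : ℝ) : ℂ)) = 1 := by
  rw [Nat.cast_natAbs, ← Complex.ofReal_intCast, Int.cast_abs, ← Complex.ofReal_mul,
    ← Complex.ofReal_mul, div_mul_div_comm, Real.mul_self_sqrt (abs_nonneg _), ← mul_div_assoc,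
    abs_mul_abs_self, div_self (mul_self_ne_zero.mpr (Int.cast_ne_zero.mpr hlam)),
    Complex.ofReal_one]

lemma inner_bwzL2 : ⟪bwzL2 hlam q f, bwzL2 hlam q' f'⟫_ℂ =
    if lam ∣ q - q' then ⟪schwartzL2 f, schwartzL2 f'⟫_ℂ else 0 := by
  set c : ℂ := ((√|(lam : ℝ)| / lam : ℝ) : ℂ)
  have hc : (lam.natAbs : ℂ) * (c * c) = 1 := natAbs_mul_bwzFactor_sq hlam
  have hint : Integrable (fun p => conj (bwzSchwartz hlam q f (coordProj p))) cubeMeasure := by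
    have hmem := (isSmooth_bwzSchwartz hlam q f).memLp.comp_measurePreserving
      measurePreserving_coordProj
    exact hmem.star.integrable one_le_two
  have hterm (k : ℤ) : ∫ p, conj (bwzSchwartz hlam q f (coordProj p)) *
      bwzTerm lam q' f' (Heis.coord.symm p) k ∂cubeMeasure = c * (residueChar lam ((q - q') * k) *
        ∫ a, conj (f (k / lam + a)) * f' (k / lam + a) ∂unitMeasure) := by
    have h := congrArg conj (integral_conj_bwzTerm_mul_bwzSchwartz hlam q q' f f' k)
    simp only [map_mul, ← integral_conj, RCLike.conj_conj, Complex.conj_ofReal, conj_residueChar,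
      ← neg_mul, neg_sub] at h
    simpa only [mul_comm (conj _)] using h
  have hsum := (hasSum_integral_mul_bwzTerm hlam q' f' hint).mul_left (lam.natAbs : ℂ)
  simp only [hterm] at hsum
  have hsum' := hsum.congr_fun fun k => show residueChar lam ((q - q') * k) *
      ∫ a, conj (f (k / lam + a)) * f' (k / lam + a) ∂unitMeasure = _ by
    rw [← mul_assoc c, ← mul_assoc _ (c * c), hc, one_mul]
  have hN : (lam.natAbs : ℂ) ≠ 0 := Nat.cast_ne_zero.mpr (Int.natAbs_ne_zero.mpr hlam)
  have hφ : Integrable fun u => conj (f u) * f' u :=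
    (f.memLp 2).star.integrable_mul (f'.memLp 2)
  rw [inner_eq_integral_cube (coeFn_bwzL2 hlam q f) (coeFn_bwzL2 hlam q' f'), inner_schwartzL2]
  refine mul_left_cancel₀ hN ?_
  rw [hasSum_residueChar_mul_integral hlam _ hφ hsum', mul_ite, mul_zero]

lemma norm_bwzL2 : ‖bwzL2 hlam q f‖ = ‖schwartzL2 f‖ := by
  rw [@norm_eq_sqrt_re_inner ℂ, @norm_eq_sqrt_re_inner ℂ, inner_bwzL2, if_pos (by simp)]

end InnerBWZ

section HermiteFunctions

variable {lam : ℤ} (hlam : lam ≠ 0)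

/-- The class of `h_{λ,q,ℓ}` in `L²(M)`. -/
noncomputable def hLp (q : ZModInt lam) (l : ℕ) : L2M :=
  (isSmooth_hFun hlam q l).memLp.toLp (hFun lam q l)

lemma coeFn_hLp (q : ZModInt lam) (l : ℕ) : hLp hlam q l =ᵐ[nilMeasure] hFun lam q l :=
  MemLp.coeFn_toLp (isSmooth_hFun hlam q l).memLp

lemma hLp_mk (q : ℤ) (l : ℕ) : hLp hlam (QuotientAddGroup.mk q) l =
    bwzL2 hlam q (hermiteSchwartz (Int.cast_ne_zero.mpr hlam) l) :=
  Lp.ext ((coeFn_hLp hlam _ l).trans (hFun_mk hlam q l ▸ (coeFn_bwzL2 hlam q _).symm))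

lemma orthonormal_hLp : Orthonormal ℂ fun i : ZModInt lam × ℕ => hLp hlam i.1 i.2 := by
  refine orthonormal_iff_ite.mpr ?_
  rintro ⟨q, l⟩ ⟨q', l'⟩
  obtain ⟨q, rfl⟩ := QuotientAddGroup.mk_surjective q
  obtain ⟨q', rfl⟩ := QuotientAddGroup.mk_surjective q'
  have hHermite := orthonormal_iff_ite.mp
    (orthonormal_hermiteSchwartz (lam := (lam : ℝ)) (Int.cast_ne_zero.mpr hlam)) l l'
  have hclass : (QuotientAddGroup.mk q : ZModInt lam) = QuotientAddGroup.mk q' ↔ lam ∣ q - q' := by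
    rw [eq_comm, QuotientAddGroup.eq, Int.mem_zmultiples_iff, neg_add_eq_sub]
  simp only [hLp_mk, inner_bwzL2, hHermite, Prod.mk.injEq, hclass, ite_and]

lemma hLp_mem_L2sub (q : ZModInt lam) (l : ℕ) : hLp hlam q l ∈ L2sub lam := by
  obtain ⟨q, rfl⟩ := QuotientAddGroup.mk_surjective q
  exact mem_L2sub_of_ae_eq_bwz (coeFn_hLp hlam _ l)

end HermiteFunctions

/-! ### Completeness on the nilmanifold -/

section Localization

/-- Smooth functions with support `(0, 1)` that converge to the indicator function of `(0, 1)`. -/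
noncomputable def unitBump (j : ℕ) : ContDiffBump (1 / 2 : ℝ) where
  rIn := 1 / 2 - 1 / (j + 3)
  rOut := 1 / 2
  rIn_pos := sub_pos.mpr <| one_div_lt_one_div_of_lt two_pos <| by
    linarith [Nat.cast_nonneg (α := ℝ) j]
  rIn_lt_rOut := sub_lt_self _ (by positivity)

lemma unitBump_eq_zero {j : ℕ} {a : ℝ} (ha : a ∉ Set.Ioo (0 : ℝ) 1) : unitBump j a = 0 := by
  refine (unitBump j).zero_of_le_dist ?_
  change 1 / 2 ≤ |a - 1 / 2|
  rw [Set.mem_Ioo, not_and_or, not_lt, not_lt] at ha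
  rcases ha with h | h
  · exact le_abs.mpr (Or.inr (by linarith))
  · exact le_abs.mpr (Or.inl (by linarith))

lemma tendsto_unitBump {a : ℝ} (ha : a ∈ Set.Ioo (0 : ℝ) 1) :
    Tendsto (fun j => unitBump j a) atTop (nhds 1) := by
  have hlt : |a - 1 / 2| < 1 / 2 := abs_lt.mpr ⟨by linarith [ha.1], by linarith [ha.2]⟩
  have hradius : Tendsto (fun j : ℕ => 1 / 2 - 1 / ((j : ℝ) + 3)) atTop (nhds (1 / 2 - 0)) :=
    (tendsto_const_nhds.div_atTop
      (tendsto_natCast_atTop_atTop.atTop_add tendsto_const_nhds)).const_sub _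
  refine tendsto_const_nhds.congr' ?_
  filter_upwards [hradius.eventually_const_le (by rwa [sub_zero])] with j hj
  exact ((unitBump j).one_of_mem_closedBall hj).symm

/-- The function `u ↦ e^{2πin(u - x)}` cut off smoothly to the interval `(x, x + 1)`. -/
noncomputable def localChar (n : ℤ) (j : ℕ) (x : ℝ) : 𝓢(ℝ, ℂ) :=
  HasCompactSupport.toSchwartzMap
    (f := fun u => unitBump j (u - x) * Complex.exp (2 * Real.pi * Complex.I * n * (u - x : ℝ)))
    (HasCompactSupport.mul_right (((unitBump j).hasCompactSupport.comp_homeomorph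
      (Homeomorph.subRight x)).comp_left Complex.ofReal_zero))
    ((Complex.ofRealCLM.contDiff.comp ((unitBump j).contDiff.comp
      (contDiff_id.sub contDiff_const))).mul (contDiff_const.mul
        (Complex.ofRealCLM.contDiff.comp (contDiff_id.sub contDiff_const))).cexp)

lemma localChar_add (n : ℤ) (j : ℕ) (x a : ℝ) : localChar n j x (x + a) =
    unitBump j a * Complex.exp (2 * Real.pi * Complex.I * n * a) := by
  change unitBump j (x + a - x) * Complex.exp (2 * Real.pi * Complex.I * n * (x + a - x : ℝ)) = _
  rw [add_sub_cancel_left]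

variable {lam : ℤ} (hlam : lam ≠ 0)

include hlam in
lemma integral_localized_eq_zero (F : ℝ × ℝ × ℝ → ℂ) {k₀ k : ℤ} {f : 𝓢(ℝ, ℂ)}
    (hf : ∀ u ∉ Set.Ioo (0 : ℝ) 1, f (k₀ / lam + u) = 0) (hdvd : lam ∣ k₀ - k) (hk : k ≠ k₀) :
    ∫ p, F p * (f (k / lam + p.1) * cubeChar 0 k lam p) ∂cubeMeasure = 0 := by
  obtain ⟨m, hm⟩ := hdvd
  have hm0 : m ≠ 0 := by
    rintro rfl
    exact hk (by linarith)
  have hlam' : (lam : ℝ) ≠ 0 := Int.cast_ne_zero.mpr hlam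
  refine integral_eq_zero_of_ae ?_
  filter_upwards [ae_mem_cube] with p hp
  have harg : (k / lam + p.1 : ℝ) = k₀ / lam + (p.1 - m) := by
    have hk₀ : (k₀ : ℝ) = k + lam * m := by exact_mod_cast (by linarith : k₀ = k + lam * m)
    rw [hk₀]
    field_simp
    ring
  have hout : p.1 - m ∉ Set.Ioo (0 : ℝ) 1 := by
    rintro ⟨hpos, hlt⟩
    rcases hm0.lt_or_gt with hneg | hpos'
    · have hle : (m : ℝ) ≤ -1 := by exact_mod_cast Int.le_sub_one_of_lt hneg
      linarith [hp.1.1]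
    · have hle : (1 : ℝ) ≤ m := by exact_mod_cast hpos'
      linarith [hp.1.2]
  rw [harg, hf _ hout, zero_mul, mul_zero]
  rfl

/-- Summation over `q` isolates the residue class of `k₀` modulo `λ`, in which the other terms
vanish because of the support of `f`. -/
lemma integral_mul_localized_eq_zero {F : ℝ × ℝ × ℝ → ℂ} (hF : Integrable F cubeMeasure)
    (h : ∀ q f, ∫ p, F p * bwzSchwartz hlam q f (coordProj p) ∂cubeMeasure = 0) {k₀ : ℤ}
    {f : 𝓢(ℝ, ℂ)} (hf : ∀ u ∉ Set.Ioo (0 : ℝ) 1, f (k₀ / lam + u) = 0) :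
    ∫ p, F p * (f (k₀ / lam + p.1) * cubeChar 0 k₀ lam p) ∂cubeMeasure = 0 := by
  let E : ℤ → ℂ := fun k => ∫ p, F p * (f (k / lam + p.1) * cubeChar 0 k lam p) ∂cubeMeasure
  have hE (q k : ℤ) : ∫ p, F p * bwzTerm lam q f (Heis.coord.symm p) k ∂cubeMeasure =
      residueChar lam (-(q * k)) * E k := by
    simp only [bwzTerm_coord_symm, mul_left_comm (F _), integral_const_mul, E]
  have hsum (q : ℕ) := (hasSum_integral_mul_bwzTerm hlam q f hF).mul_left (residueChar lam (k₀ * q))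
  simp only [hE, h, mul_zero] at hsum
  have htotal := hasSum_sum fun q (_ : q ∈ Finset.range lam.natAbs) => hsum q
  have hterm (k : ℤ) : ∑ q ∈ Finset.range lam.natAbs, residueChar lam (k₀ * q) *
      (((√|(lam : ℝ)| / lam : ℝ) : ℂ) * (residueChar lam (-(q * k)) * E k)) =
        ((√|(lam : ℝ)| / lam : ℝ) : ℂ) * E k * if lam ∣ k₀ - k then (lam.natAbs : ℂ) else 0 := by
    rw [← sum_residueChar hlam, Finset.mul_sum]
    refine Finset.sum_congr rfl fun q _ => ?_
    rw [sub_mul, sub_eq_add_neg, residueChar_add, mul_comm k]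
    ring
  have hother (k : ℤ) (hk : k ≠ k₀) : ((√|(lam : ℝ)| / lam : ℝ) : ℂ) * E k *
      (if lam ∣ k₀ - k then (lam.natAbs : ℂ) else 0) = 0 := by
    split_ifs with hdvd
    · rw [show E k = 0 from integral_localized_eq_zero hlam F hf hdvd hk, mul_zero, zero_mul]
    · exact mul_zero _
  simp only [hterm, Finset.sum_const_zero] at htotal
  have hzero := (hasSum_single k₀ hother).unique htotal
  rw [sub_self, if_pos (dvd_zero lam)] at hzero
  have hfactor := left_ne_zero_of_mul_eq_one (natAbs_mul_bwzFactor_sq hlam)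
  have hfactor' := left_ne_zero_of_mul (right_ne_zero_of_mul_eq_one (natAbs_mul_bwzFactor_sq hlam))
  exact (mul_eq_zero.mp ((mul_eq_zero.mp hzero).resolve_right hfactor)).resolve_left hfactor'

lemma inner_bwzL2_eq_zero {g : L2M} (hg : ∀ q l, ⟪g, hLp hlam q l⟫_ℂ = 0) (q : ℤ) (f : 𝓢(ℝ, ℂ)) :
    ⟪g, bwzL2 hlam q f⟫_ℂ = 0 := by
  let T : Lp ℂ 2 (volume : Measure ℝ) →L[ℂ] L2M :=
    (bwzL2 hlam q).extendOfNorm schwartzL2.toLinearMap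
  have hT (f : 𝓢(ℝ, ℂ)) : T (schwartzL2 f) = bwzL2 hlam q f :=
    LinearMap.extendOfNorm_eq (e := schwartzL2.toLinearMap)
      (denseRange_toLpCLM (p := 2) (μ := volume) ENNReal.ofNat_ne_top)
      ⟨1, fun f => by rw [norm_bwzL2, one_mul]; rfl⟩ f
  have hbasis := (hermiteBasis (Int.cast_ne_zero (α := ℝ).mpr hlam)).dense_span
  have hvanish : innerSL ℂ g ∘L T = 0 := by
    refine ContinuousLinearMap.ext_on
      (Submodule.dense_iff_topologicalClosure_eq_top.mpr hbasis) ?_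
    rintro _ ⟨l, rfl⟩
    rw [hermiteBasis_apply]
    change ⟪g, T _⟫_ℂ = 0
    rw [hT, ← hLp_mk, hg]
  rw [← hT]
  exact congrArg (fun φ => φ (schwartzL2 f)) hvanish

lemma integral_mul_cubeChar_eq_zero {F : ℝ × ℝ × ℝ → ℂ} (hF : Integrable F cubeMeasure)
    (h : ∀ q f, ∫ p, F p * bwzSchwartz hlam q f (coordProj p) ∂cubeMeasure = 0) (n k : ℤ) :
    ∫ p, F p * cubeChar n k lam p ∂cubeMeasure = 0 := by
  have hzero (j : ℕ) : ∫ p, F p * (unitBump j p.1 * cubeChar n k lam p) ∂cubeMeasure = 0 := by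
    have hlocal := integral_mul_localized_eq_zero hlam hF h (k₀ := k) (f := localChar n j (k / lam))
      fun u hu => by rw [localChar_add, unitBump_eq_zero hu, Complex.ofReal_zero, zero_mul]
    refine (integral_congr_ae (ae_of_all _ fun p => ?_)).trans hlocal
    rw [cubeChar_eq_exp_mul n, localChar_add, mul_assoc (unitBump j p.1 : ℂ)]
  have hinterior : ∀ᵐ p ∂cubeMeasure, p.1 ∈ Set.Ioo (0 : ℝ) 1 := by
    refine Measure.quasiMeasurePreserving_fst.ae (p := fun a => a ∈ Set.Ioo (0 : ℝ) 1) ?_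
    rw [unitMeasure, ← Measure.restrict_congr_set Ioo_ae_eq_Ico]
    exact ae_restrict_mem measurableSet_Ioo
  have hlim := tendsto_integral_of_dominated_convergence (μ := cubeMeasure)
    (F := fun j p => F p * (unitBump j p.1 * cubeChar n k lam p))
    (f := fun p => F p * cubeChar n k lam p) (fun p => ‖F p‖) (fun j => ?_) hF.norm
    (fun j => ae_of_all _ fun p => ?_) ?_
  · simp only [hzero] at hlim
    exact tendsto_nhds_unique hlim tendsto_const_nhds
  · exact hF.aestronglyMeasurable.mul ((Complex.continuous_ofReal.comp
      ((unitBump j).continuous.comp continuous_fst)).mul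
        (continuous_cubeChar n k lam)).aestronglyMeasurable
  · rw [norm_mul, norm_mul, norm_cubeChar, mul_one, Complex.norm_real,
      Real.norm_of_nonneg (unitBump j).nonneg]
    exact mul_le_of_le_one_right (norm_nonneg _) (unitBump j).le_one
  · filter_upwards [hinterior] with p hp
    simpa using ((Complex.continuous_ofReal.tendsto _).comp (tendsto_unitBump hp)).mul_const
      (cubeChar n k lam p) |>.const_mul (F p)

end Localization

section Completeness

lemma eq_zero_of_inner_eq_zero {g : L2M} (hchi : ∀ ω, ⟪g, chiLp ω⟫_ℂ = 0)
    (hbwz : ∀ (lam : ℤ) (hlam : lam ≠ 0) q l, ⟪g, hLp hlam q l⟫_ℂ = 0) : g = 0 := by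
  have hmem : MemLp (fun p => g (coordProj p)) 2 cubeMeasure :=
    (Lp.memLp g).comp_measurePreserving measurePreserving_coordProj
  have hcoeff (n k l : ℤ) : ∫ p, conj (g (coordProj p)) * cubeChar n k l p ∂cubeMeasure = 0 := by
    rcases eq_or_ne l 0 with rfl | hl
    · rw [← hchi (n, k), inner_eq_integral_cube (ae_eq_refl g) (coeFn_chiLp (n, k))]
      simp only [chi_coordProj_eq_cubeChar]
    · refine integral_mul_cubeChar_eq_zero hl (hmem.star.integrable one_le_two) (fun q f => ?_) n k
      rw [← inner_bwzL2_eq_zero hl (hbwz l hl) q f]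
      exact (inner_eq_integral_cube (ae_eq_refl g) (coeFn_bwzL2 hl q f)).symm
  have hzero := ae_eq_zero_of_integral_conj_cubeChar_mul hmem fun n k l => by
    simpa [← integral_conj, mul_comm] using congrArg conj (hcoeff n k l)
  rw [← inner_self_eq_zero (𝕜 := ℂ), inner_eq_integral_cube (ae_eq_refl g) (ae_eq_refl g)]
  refine integral_eq_zero_of_ae ?_
  filter_upwards [hzero] with p hp
  exact mul_eq_zero_of_right _ hp

end Completeness

/-! ### The basis of eigenfunctions -/

section HilbertBasis

variable {𝕜 E ι κ γ : Type*} [RCLike 𝕜] [NormedAddCommGroup E] [InnerProductSpace 𝕜 E]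
  {V : γ → Submodule 𝕜 E} {c : ι → γ}

lemma isHilbertSum_of_hilbertBasis_mem [CompleteSpace E] [∀ j, CompleteSpace (V j)]
    (hV : OrthogonalFamily 𝕜 (fun j => V j) fun j => (V j).subtypeₗᵢ) (b : HilbertBasis ι 𝕜 E)
    (hb : ∀ i, b i ∈ V (c i)) : IsHilbertSum 𝕜 (fun j => V j) fun j => (V j).subtypeₗᵢ := by
  refine IsHilbertSum.mkInternal _ hV ?_
  rw [← b.dense_span]
  refine Submodule.topologicalClosure_mono (Submodule.span_le.mpr ?_)
  rintro _ ⟨i, rfl⟩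
  exact Submodule.mem_iSup_of_mem (c i) (hb i)

lemma exists_hilbertBasis_of_hilbertBasis_mem {j : γ} [CompleteSpace (V j)]
    (hV : OrthogonalFamily 𝕜 (fun j => V j) fun j => (V j).subtypeₗᵢ) (b : HilbertBasis ι 𝕜 E)
    (hb : ∀ i, b i ∈ V (c i)) {f : κ → ι} (hf : Function.Injective f)
    (hrange : ∀ i, i ∈ Set.range f ↔ c i = j) :
    ∃ e : HilbertBasis κ 𝕜 (V j), ∀ k, (e k : E) = b (f k) := by
  have hmem (k : κ) : b (f k) ∈ V j := (hrange (f k)).mp ⟨k, rfl⟩ ▸ hb (f k)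
  have horth : Orthonormal 𝕜 fun k => (⟨b (f k), hmem k⟩ : V j) :=
    (b.orthonormal.comp f hf).codRestrict (V j) hmem
  have hbot : (Submodule.span 𝕜 (Set.range fun k => (⟨b (f k), hmem k⟩ : V j)))ᗮ = ⊥ := by
    refine (Submodule.eq_bot_iff _).mpr fun x hx => ?_
    rw [Submodule.mem_orthogonal] at hx
    have hzero (i : ι) : ⟪b i, (x : E)⟫_𝕜 = 0 := by
      by_cases hi : c i = j
      · obtain ⟨k, rfl⟩ := (hrange i).mpr hi
        exact hx _ (Submodule.subset_span ⟨k, rfl⟩)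
      · exact hV hi ⟨b i, hb i⟩ x
    exact Subtype.ext (b.repr.map_eq_zero_iff.mp (lp.ext (funext fun i =>
      (b.repr_apply_apply x i).trans (hzero i))))
  exact ⟨HilbertBasis.mkOfOrthogonalEqBot horth hbot, fun k => by
    rw [HilbertBasis.coe_mkOfOrthogonalEqBot]⟩

end HilbertBasis

section Eigenbasis

/-- All the normalised eigenfunctions, as elements of `L²(M)`. -/
noncomputable def eigenLp : (ℤ × ℤ) ⊕ HIndex → L2M :=
  Sum.elim chiLp fun i => hLp i.1.2 i.2.1 i.2.2

/-- The central frequency `λ` of an eigenfunction; it is `0` for the characters. -/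
def centralFreq : (ℤ × ℤ) ⊕ HIndex → ℤ :=
  Sum.elim 0 fun i => i.1.1

lemma chiLp_mem_L2sub (ω : ℤ × ℤ) : chiLp ω ∈ L2sub 0 :=
  mem_L2sub_of_ae_eq_chi (coeFn_chiLp ω)

lemma eigenLp_mem_L2sub (i : (ℤ × ℤ) ⊕ HIndex) : eigenLp i ∈ L2sub (centralFreq i) := by
  rcases i with ω | ⟨⟨lam, hlam⟩, q, l⟩
  · exact chiLp_mem_L2sub ω
  · exact hLp_mem_L2sub hlam q l

lemma orthogonalFamily_L2sub :
    OrthogonalFamily ℂ (fun lam => L2sub lam) fun lam => (L2sub lam).subtypeₗᵢ :=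
  fun _ _ h f g => inner_eq_zero_of_mem_L2sub h f.2 g.2

lemma orthonormal_eigenLp : Orthonormal ℂ eigenLp := by
  refine ⟨?_, fun i j hij => ?_⟩
  · rintro (ω | ⟨⟨lam, hlam⟩, i⟩)
    · exact orthonormal_chiLp.norm_eq_one ω
    · exact (orthonormal_hLp hlam).norm_eq_one i
  by_cases h : centralFreq i = centralFreq j
  · rcases i with ω | ⟨⟨lam, hlam⟩, i⟩ <;> rcases j with ω' | ⟨⟨mu, hmu⟩, j⟩
    · exact orthonormal_chiLp.inner_eq_zero (ne_of_apply_ne Sum.inl hij)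
    · exact absurd h.symm hmu
    · exact absurd h hlam
    · obtain rfl : lam = mu := h
      exact (orthonormal_hLp hlam).inner_eq_zero fun h => hij <|
        congrArg (fun k => Sum.inr (⟨⟨lam, hlam⟩, k⟩ : HIndex)) h
  · exact inner_eq_zero_of_mem_L2sub h (eigenLp_mem_L2sub i) (eigenLp_mem_L2sub j)

lemma orthogonal_span_eigenLp : (Submodule.span ℂ (Set.range eigenLp))ᗮ = ⊥ := by
  refine (Submodule.eq_bot_iff _).mpr fun g hg => ?_
  have hinner (i) : ⟪g, eigenLp i⟫_ℂ = 0 :=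
    Submodule.inner_left_of_mem_orthogonal (Submodule.subset_span (Set.mem_range_self i)) hg
  exact eq_zero_of_inner_eq_zero (fun ω => hinner (Sum.inl ω))
    fun lam hlam q l => hinner (Sum.inr ⟨⟨lam, hlam⟩, q, l⟩)

/-- The orthonormal basis of `L²(M)` that consists of eigenfunctions of the sub-Laplacian. -/
noncomputable def eigenbasis : HilbertBasis ((ℤ × ℤ) ⊕ HIndex) ℂ L2M :=
  HilbertBasis.mkOfOrthogonalEqBot orthonormal_eigenLp orthogonal_span_eigenLp

lemma eigenbasis_apply (i : (ℤ × ℤ) ⊕ HIndex) : eigenbasis i = eigenLp i :=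
  congrFun (HilbertBasis.coe_mkOfOrthogonalEqBot _ _) i

lemma eigenbasis_mem_L2sub (i : (ℤ × ℤ) ⊕ HIndex) : eigenbasis i ∈ L2sub (centralFreq i) :=
  eigenbasis_apply i ▸ eigenLp_mem_L2sub i

lemma eigenbasis_inl_ae_eq (ω : ℤ × ℤ) : eigenbasis (Sum.inl ω) =ᵐ[nilMeasure] chi ω := by
  rw [eigenbasis_apply]
  exact coeFn_chiLp ω

lemma eigenbasis_inr_ae_eq (i : HIndex) :
    eigenbasis (Sum.inr i) =ᵐ[nilMeasure] hFun i.1.1 i.2.1 i.2.2 := by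
  rw [eigenbasis_apply]
  exact coeFn_hLp i.1.2 i.2.1 i.2.2

lemma exists_hilbertBasis_chi : ∃ e : HilbertBasis (ℤ × ℤ) ℂ (L2sub 0),
    ∀ ω : ℤ × ℤ, ((e ω : L2M) : Nil → ℂ) =ᵐ[nilMeasure] chi ω := by
  obtain ⟨e, he⟩ := exists_hilbertBasis_of_hilbertBasis_mem orthogonalFamily_L2sub eigenbasis
    eigenbasis_mem_L2sub (f := Sum.inl) (j := 0) Sum.inl_injective (by
      rintro (ω | i)
      · exact iff_of_true ⟨ω, rfl⟩ rfl
      · exact iff_of_false (by simp) i.1.2)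
  exact ⟨e, fun ω => he ω ▸ eigenbasis_inl_ae_eq ω⟩

lemma exists_hilbertBasis_hFun {lam : ℤ} (hlam : lam ≠ 0) :
    ∃ e : HilbertBasis (ZModInt lam × ℕ) ℂ (L2sub lam), ∀ (q : ZModInt lam) (l : ℕ),
      ((e (q, l) : L2M) : Nil → ℂ) =ᵐ[nilMeasure] hFun lam q l := by
  let f : ZModInt lam × ℕ → (ℤ × ℤ) ⊕ HIndex := fun i => Sum.inr ⟨⟨lam, hlam⟩, i⟩
  obtain ⟨e, he⟩ := exists_hilbertBasis_of_hilbertBasis_mem orthogonalFamily_L2sub eigenbasis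
    eigenbasis_mem_L2sub (f := f) (j := lam)
    (Sum.inr_injective.comp sigma_mk_injective) (by
      rintro (ω | ⟨⟨mu, hmu⟩, i⟩)
      · exact iff_of_false (by simp [f]) hlam.symm
      · refine ⟨?_, ?_⟩
        · rintro ⟨i, hi⟩
          exact (congrArg centralFreq hi).symm
        · rintro (rfl : mu = lam)
          exact ⟨i, rfl⟩)
  exact ⟨e, fun q l => he (q, l) ▸ eigenbasis_inr_ae_eq _⟩

end Eigenbasis

end HeisenbergNil

theorem theorem3p1 :
    -- the characters are smooth, normalised eigenfunctions
    (∀ ω : ℤ × ℤ,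
      IsSmooth (chi ω) ∧
      MeasureTheory.MemLp (chi ω) 2 nilMeasure ∧
      MeasureTheory.eLpNorm (chi ω) 2 nilMeasure = 1 ∧
      subLaplacian (chi ω) =
        fun p => (((2 * Real.pi) ^ 2 * ((ω.1 : ℝ) ^ 2 + (ω.2 : ℝ) ^ 2) : ℝ) : ℂ) * chi ω p) ∧
    -- the series that define the `h_{λ,q,ℓ}` converge absolutely at every point
    (∀ lam : ℤ, lam ≠ 0 → ∀ (q : ℤ) (l : ℕ) (x : Heis),
      Summable (bwzTerm lam q (fun u => (hermiteScaled l lam u : ℂ)) x)) ∧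
    -- the `h_{λ,q,ℓ}` are smooth, normalised eigenfunctions
    (∀ lam : ℤ, lam ≠ 0 → ∀ (q : ZModInt lam) (l : ℕ),
      IsSmooth (hFun lam q l) ∧
      MeasureTheory.MemLp (hFun lam q l) 2 nilMeasure ∧
      MeasureTheory.eLpNorm (hFun lam q l) 2 nilMeasure = 1 ∧
      subLaplacian (hFun lam q l) =
        fun p => ((2 * Real.pi * |(lam : ℝ)| * (2 * (l : ℝ) + 1) : ℝ) : ℂ) * hFun lam q l p) ∧
    -- `L²(M)` is the orthogonal Hilbert sum of the `L²_λ(M)`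
    IsHilbertSum ℂ (fun lam : ℤ => L2sub lam) (fun lam : ℤ => (L2sub lam).subtypeₗᵢ) ∧
    -- all these functions together form an orthonormal basis of `L²(M)`
    (∃ e : HilbertBasis ((ℤ × ℤ) ⊕ HIndex) ℂ L2M,
      (∀ ω : ℤ × ℤ, e (Sum.inl ω) =ᵐ[nilMeasure] chi ω) ∧
      ∀ i : HIndex, e (Sum.inr i) =ᵐ[nilMeasure] hFun i.1.1 i.2.1 i.2.2) ∧
    -- the characters form an orthonormal basis of `L²_0(M)`
    (∃ e : HilbertBasis (ℤ × ℤ) ℂ (L2sub 0),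
      ∀ ω : ℤ × ℤ, ((e ω : L2M) : Nil → ℂ) =ᵐ[nilMeasure] chi ω) ∧
    -- for each `λ ≠ 0` the `h_{λ,q,ℓ}` form an orthonormal basis of `L²_λ(M)`
    (∀ lam : ℤ, lam ≠ 0 → ∃ e : HilbertBasis (ZModInt lam × ℕ) ℂ (L2sub lam),
      ∀ (q : ZModInt lam) (l : ℕ),
        ((e (q, l) : L2M) : Nil → ℂ) =ᵐ[nilMeasure] hFun lam q l) := by
  refine ⟨fun ω => ?_, fun lam hlam q l x => summable_bwzTerm_hermiteScaled hlam q l x,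
    fun lam hlam q l => ?_, ?_, ?_, exists_hilbertBasis_chi,
    fun lam hlam => exists_hilbertBasis_hFun hlam⟩
  · exact ⟨isSmooth_chi ω, (isSmooth_chi ω).memLp,
      eLpNorm_eq_one_of_norm_toLp _ (orthonormal_chiLp.norm_eq_one ω), subLaplacian_chi ω⟩
  · exact ⟨isSmooth_hFun hlam q l, (isSmooth_hFun hlam q l).memLp,
      eLpNorm_eq_one_of_norm_toLp _ ((orthonormal_hLp hlam).norm_eq_one (q, l)),
      subLaplacian_hFun hlam q l⟩
  · exact isHilbertSum_of_hilbertBasis_mem orthogonalFamily_L2sub eigenbasis eigenbasis_mem_L2sub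
  · exact ⟨eigenbasis, eigenbasis_inl_ae_eq, eigenbasis_inr_ae_eq⟩
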